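/- Let $\{\alpha_j\}_{j\in\mathbb Z}$ be any two-sided sequence in the open unit disc $\{z\in\mathbb C:|z|<1\}$. For $|\alpha|<1$ put $\rho(\alpha)=(1-|\alpha|^2)^{1/2}$ and $$\Theta(\alpha)=\begin{pmatrix}\bar\alpha&\rho(\alpha)\\ \rho(\alpha)&-\alpha\end{pmatrix}.$$ On $\ell^2(\mathbb Z)$ with standard basis $(\delta_j)_{j\in\mathbb Z}$ let $\mathcal M=\bigoplus_{n\in\mathbb Z}\Theta(\alpha_{2n})$, where $\Theta(\alpha_{2n})$ acts on the span of $(\delta_{2n},\delta_{2n+1})$, let $\mathcal L=\bigoplus_{n\in\mathbb Z}\Theta(\alpha_{2n+1})$, where $\Theta(\alpha_{2n+1})$ acts on the span of $(\delta_{2n+1},\delta_{2n+2})$, and let $\mathcal E=\mathcal L\mathcal M$ be the (unitary) extended CMV matrix. Then $\mathcal E$ has simple singular spectrum. That is, for $\psi\in\ell^2(\mathbb Z)$ let $\mu_\psi$ be the spectral measure of $\psi$, the finite Borel measure on the unit circle with $\int z^n\,d\mu_\psi(z)=\langle\psi,\mathcal E^n\psi\rangle$ for all $n\in\mathbb Z$,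 and let $\mathcal H_{\rm s}$ be the set of all $\psi$ for which $\mu_\psi$ is singular with respect to Lebesgue (arc length) measure on the circle. Then there is a $\varphi\in\mathcal H_{\rm s}$ such that the closed linear span of $\{\mathcal E^n\varphi:n\in\mathbb Z\}$ equals $\mathcal H_{\rm s}$. -/

import Mathlib

open Complex MeasureTheory
open scoped ComplexConjugate InnerProductSpace

noncomputable section

namespace ExtCMV

/-! ### Simple singular spectrum of a unitary operator -/

/-- The unit circle carries its Borel σ-algebra. -/
instance : MeasurableSpace Circle := borel Circle

instance : BorelSpace Circle := ⟨rfl⟩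

/-- Lebesgue (arc length) measure on the unit circle. -/
def arcLength : Measure Circle :=
  Measure.map Circle.exp (volume.restrict (Set.Ioc (-Real.pi) Real.pi))

section Unitary

variable {H : Type*} [NormedAddCommGroup H] [InnerProductSpace ℂ H]

/-- `μ` is the spectral measure of the vector `ψ` for the unitary operator `U`: the finite Borel
measure on the circle with `∫ zⁿ dμ(z) = ⟪ψ, Uⁿ ψ⟫` for all integers `n`
(these moments determine a finite measure on the circle). -/
def IsSpectralMeasure (U : H ≃ₗᵢ[ℂ] H) (ψ : H) (μ : Measure Circle) : Prop :=
  IsFiniteMeasure μ ∧ ∀ n : ℤ, ∫ z : Circle, (z : ℂ) ^ n ∂μ = ⟪ψ, (U ^ n) ψ⟫_ℂ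

/-- The singular subspace of the unitary operator `U`: the vectors whose spectral measure is
singular with respect to Lebesgue measure (both pure point and singular continuous parts are
included). -/
def singularSubspace (U : H ≃ₗᵢ[ℂ] H) : Set H :=
  {ψ | ∃ μ : Measure Circle, IsSpectralMeasure U ψ μ ∧ μ ⟂ₘ arcLength}

/-- The cyclic subspace generated by `φ` and the unitary operator `U`: the closed linear span of
the vectors `Uⁿ φ`, `n ∈ ℤ`. -/
def cyclicSubspace (U : H ≃ₗᵢ[ℂ] H) (φ : H) : Submodule ℂ H :=
  (Submodule.span ℂ (Set.range fun n : ℤ => (U ^ n) φ)).topologicalClosure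

/-- `U` has simple singular spectrum: the restriction of `U` to its singular subspace has a
cyclic vector. -/
def HasSimpleSingularSpectrum (U : H ≃ₗᵢ[ℂ] H) : Prop :=
  ∃ φ ∈ singularSubspace U, (cyclicSubspace U φ : Set H) = singularSubspace U

end Unitary

/-! ### Extended CMV matrices -/

/-- `ℓ²(ℤ)`. -/
abbrev L2Z : Type := lp (fun _ : ℤ => ℂ) 2

/-- `ρ = (1 - |α|²)^{1/2}`. -/
def rho (a : UnitDisc) : ℝ := Real.sqrt (1 - ‖(a : ℂ)‖ ^ 2)

/-- The `2 × 2` matrix `Θ(α)`. -/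
def Theta (a : UnitDisc) : Matrix (Fin 2) (Fin 2) ℂ :=
  !![conj (a : ℂ), (rho a : ℂ); (rho a : ℂ), -(a : ℂ)]

/-- The action on sequences of the direct sum of the matrices `Θ(α j)`, `j ≡ s` mod `2`, where
`Θ(α j)` acts on the span of `δ_j, δ_{j+1}`. -/
def blockFun (s : ℤ) (α : ℤ → UnitDisc) (u : ℤ → ℂ) (j : ℤ) : ℂ :=
  if Even (j - s) then Theta (α j) 0 0 * u j + Theta (α j) 0 1 * u (j + 1)
  else Theta (α (j - 1)) 1 0 * u (j - 1) + Theta (α (j - 1)) 1 1 * u j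

theorem even_sub_one_sub {j s : ℤ} (h : ¬ Even (j - s)) : Even (j - 1 - s) := by
  grind

theorem not_even_add_one_sub {j s : ℤ} (h : Even (j - s)) : ¬ Even (j + 1 - s) := by
  grind

theorem rho_sq (a : UnitDisc) : ((rho a : ℝ) : ℂ) * (rho a : ℂ) = 1 - (a : ℂ) * conj (a : ℂ) := by
  have h : rho a * rho a = 1 - ‖(a : ℂ)‖ ^ 2 :=
    Real.mul_self_sqrt (by linarith [a.sq_norm_lt_one])
  rw [← ofReal_mul, h, Complex.mul_conj, Complex.normSq_eq_norm_sq]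
  push_cast
  ring

theorem rho_star (a : UnitDisc) : rho (star a) = rho a := by
  simp [rho]

/-- `Θ(ᾱ)` is the inverse of `Θ(α)`. -/
theorem blockFun_star (s : ℤ) (α : ℤ → UnitDisc) (u : ℤ → ℂ) :
    blockFun s (fun j => star (α j)) (blockFun s α u) = u := by
  funext j
  by_cases h : Even (j - s)
  · have h' := not_even_add_one_sub h
    simp only [blockFun, h, h', if_true, if_false, Theta, rho_star, UnitDisc.coe_star]
    simp
    linear_combination u j * rho_sq (α j)
  · have h' := even_sub_one_sub h
    simp only [blockFun, h, h', if_true, if_false, Theta, rho_star, UnitDisc.coe_star]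
    simp
    linear_combination u j * rho_sq (α (j - 1))

/-- The involution of `ℤ` that exchanges the two indices of each block. -/
def partner (s : ℤ) : ℤ ≃ ℤ where
  toFun j := if Even (j - s) then j + 1 else j - 1
  invFun j := if Even (j - s) then j + 1 else j - 1
  left_inv j := by grind
  right_inv j := by grind

theorem theta_norm_sq (a : UnitDisc) (x y : ℂ) :
    ‖conj (a : ℂ) * x + (rho a : ℂ) * y‖ ^ 2 + ‖(rho a : ℂ) * x + -(a : ℂ) * y‖ ^ 2
      = ‖x‖ ^ 2 + ‖y‖ ^ 2 := by
  have h := rho_sq a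
  have key : ∀ z : ℂ, ((‖z‖ ^ 2 : ℝ) : ℂ) = z * conj z := by
    intro z
    rw [Complex.mul_conj, Complex.normSq_eq_norm_sq]
  apply Complex.ofReal_injective
  rw [ofReal_add, ofReal_add, key, key, key, key]
  simp only [map_add, map_mul, map_neg, conj_conj, conj_ofReal]
  linear_combination (x * conj x + y * conj y) * h

theorem blockFun_norm_sq (s : ℤ) (α : ℤ → UnitDisc) (u : ℤ → ℂ) (j : ℤ) :
    ‖blockFun s α u j‖ ^ 2 + ‖blockFun s α u (partner s j)‖ ^ 2
      = ‖u j‖ ^ 2 + ‖u (partner s j)‖ ^ 2 := by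
  by_cases h : Even (j - s)
  · have h' := not_even_add_one_sub h
    have hp : partner s j = j + 1 := if_pos h
    simpa [hp, blockFun, h, h', Theta] using theta_norm_sq (α j) (u j) (u (j + 1))
  · have h' := even_sub_one_sub h
    have hp : partner s j = j - 1 := if_neg h
    have := theta_norm_sq (α (j - 1)) (u (j - 1)) (u j)
    rw [hp, add_comm, add_comm (‖u j‖ ^ 2)]
    simpa [blockFun, h, h', Theta] using this

theorem summable_sq (u : L2Z) : Summable fun j => ‖u j‖ ^ 2 := by
  simpa using (lp.hasSum_norm (p := 2) (by norm_num) u).summable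

theorem norm_sq_eq (u : L2Z) : ‖u‖ ^ 2 = ∑' j, ‖u j‖ ^ 2 := by
  simpa using (lp.hasSum_norm (p := 2) (by norm_num) u).tsum_eq.symm

theorem summable_blockFun (s : ℤ) (α : ℤ → UnitDisc) (u : L2Z) :
    Summable fun j => ‖blockFun s α u j‖ ^ 2 := by
  refine Summable.of_nonneg_of_le (fun j => by positivity) (fun j => ?_)
    ((summable_sq u).add ((partner s).summable_iff.mpr (summable_sq u)))
  have := blockFun_norm_sq s α u j
  have h2 : 0 ≤ ‖blockFun s α u (partner s j)‖ ^ 2 := by positivity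
  simp only [Function.comp]
  linarith

theorem memℓp_blockFun (s : ℤ) (α : ℤ → UnitDisc) (u : L2Z) : Memℓp (blockFun s α u) 2 :=
  memℓp_gen (by simpa using summable_blockFun s α u)

/-- The direct sum of the matrices `Θ(α j)`, `j ≡ s` mod `2`, as a linear map of `ℓ²(ℤ)`. -/
def blockLin (s : ℤ) (α : ℤ → UnitDisc) : L2Z →ₗ[ℂ] L2Z where
  toFun u := ⟨blockFun s α u, memℓp_blockFun s α u⟩
  map_add' u v := by
    ext j
    simp only [blockFun, lp.coeFn_add, Pi.add_apply]
    split_ifs <;> ring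
  map_smul' c u := by
    ext j
    simp only [blockFun, lp.coeFn_smul, Pi.smul_apply, smul_eq_mul, RingHom.id_apply]
    split_ifs <;> ring

theorem norm_blockLin (s : ℤ) (α : ℤ → UnitDisc) (u : L2Z) : ‖blockLin s α u‖ = ‖u‖ := by
  have hb : Summable fun j => ‖blockLin s α u j‖ ^ 2 := summable_blockFun s α u
  have hu := summable_sq u
  have e1 := (partner s).tsum_eq (fun j => ‖blockLin s α u j‖ ^ 2)
  have e2 := (partner s).tsum_eq (fun j => ‖u j‖ ^ 2)
  have h1 := hb.tsum_add ((partner s).summable_iff.mpr hb)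
  have h2 := hu.tsum_add ((partner s).summable_iff.mpr hu)
  have h3 : (∑' j, (‖blockLin s α u j‖ ^ 2 + ‖blockLin s α u (partner s j)‖ ^ 2))
      = ∑' j, (‖u j‖ ^ 2 + ‖u (partner s j)‖ ^ 2) :=
    tsum_congr fun j => blockFun_norm_sq s α u j
  simp only [Function.comp] at h1 h2
  have : ‖blockLin s α u‖ ^ 2 = ‖u‖ ^ 2 := by
    rw [norm_sq_eq, norm_sq_eq]
    linarith
  exact (sq_eq_sq₀ (norm_nonneg _) (norm_nonneg _)).mp this

/-- The direct sum of the matrices `Θ(α j)`, `j ≡ s` mod `2`, where `Θ(α j)` acts on the span of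
`δ_j, δ_{j+1}`, as a unitary operator on `ℓ²(ℤ)`. -/
def block (s : ℤ) (α : ℤ → UnitDisc) : L2Z ≃ₗᵢ[ℂ] L2Z where
  toLinearEquiv := LinearEquiv.ofLinearMap (blockLin s α) (blockLin s fun j => star (α j))
    (by
      ext1 u
      refine lp.ext ?_
      have h := blockFun_star s (fun j => star (α j)) u
      simp only [star_star] at h
      exact h)
    (by
      ext1 u
      exact lp.ext (blockFun_star s α u))
  norm_map' := norm_blockLin s α

/-- `M`, the direct sum of the `Θ(α_{2n})` acting on the span of `δ_{2n}, δ_{2n+1}`. -/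
def opM (α : ℤ → UnitDisc) : L2Z ≃ₗᵢ[ℂ] L2Z := block 0 α

/-- `L`, the direct sum of the `Θ(α_{2n+1})` acting on the span of `δ_{2n+1}, δ_{2n+2}`. -/
def opL (α : ℤ → UnitDisc) : L2Z ≃ₗᵢ[ℂ] L2Z := block 1 α

/-- The extended CMV matrix `E = L M`, as a unitary operator on `ℓ²(ℤ)`. -/
def extendedCMV (α : ℤ → UnitDisc) : L2Z ≃ₗᵢ[ℂ] L2Z := opL α * opM α

end ExtCMV

end

/-! Let E be the extended CMV matrix. A suitable vector φ = φ₁ + φ₂, with φ₁ a multiple of δ_0 and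
φ₂ of δ_1, has the property that the reflection R sending φ to -φ turns the block Θ(α_0) into a
diagonal one. Then E' = E R splits along j ≤ 0 and j ≥ 1, and φ₁, φ₂ generate orthogonal E'-cyclic
subspaces whose sum is dense (`isOrthogonalCyclicPair_decoupledCMV`).

Let C be the E-cyclic subspace of φ and η the part of φ₁ orthogonal to C. The cyclic subspaces of φ
and η under E are orthogonal with dense sum. On the orthogonal complement of C the operators E and
E' agree, so the spectral measure of η is the same for both, and it is absolutely continuous with
respect to the E'-spectral measure ν of φ. By Aronszajn–Donoghue (`mutuallySingular_of_reflection`)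
the singular parts of ν and of the E-spectral measure μ of φ are mutually singular. Hence so are the
singular parts of the spectral measures of φ and η under E.

In the model L²(μ) ⊕ L²(μ_η), the singular subspace consists of the functions supported on a
Lebesgue null set N carrying both singular parts. Mutual singularity there makes the pair of
indicators of N a cyclic vector (`IsOrthogonalCyclicPair.hasSimpleSingularSpectrum`). -/

noncomputable section

namespace ExtCMV

open Filter Topology

/-! ### Laurent monomials on the circle -/

/-- The continuous function `z ↦ zⁿ` on the circle. -/
def circlePow (n : ℤ) : C(Circle, ℂ) := ⟨fun z => ((z ^ n : Circle) : ℂ),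
  (by fun_prop : Continuous fun z : Circle => (z : ℂ)).comp (continuous_zpow n)⟩

@[simp] theorem circlePow_apply (n : ℤ) (z : Circle) : circlePow n z = (z : ℂ) ^ n := by
  simp [circlePow]

theorem circlePow_add (m n : ℤ) : circlePow (m + n) = circlePow m * circlePow n := by
  ext z
  simp [zpow_add₀ (Circle.coe_ne_zero z)]

theorem circlePow_zero : circlePow 0 = 1 := by ext z; simp

theorem star_circlePow (n : ℤ) : star (circlePow n) = circlePow (-n) := by
  ext z
  simp [← Circle.coe_inv_eq_conj]

/-- The star subalgebra of Laurent polynomials. -/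
def laurentSubalgebra : StarSubalgebra ℂ C(Circle, ℂ) where
  toSubalgebra := Algebra.adjoin ℂ (Set.range circlePow)
  star_mem' := by
    change Algebra.adjoin ℂ (Set.range circlePow) ≤
      star (Algebra.adjoin ℂ (Set.range circlePow))
    refine Algebra.adjoin_le ?_
    rintro - ⟨n, rfl⟩
    exact Algebra.subset_adjoin ⟨-n, (star_circlePow n).symm⟩

/-- The monomials are closed under products, so their linear span is already an algebra;
Stone–Weierstrass can then be read as density of a span. -/
theorem laurentSubalgebra_coe :
    Subalgebra.toSubmodule laurentSubalgebra.toSubalgebra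
      = Submodule.span ℂ (Set.range circlePow) := by
  apply Algebra.adjoin_eq_span_of_subset
  refine Set.Subset.trans ?_ Submodule.subset_span
  intro x hx
  refine Submonoid.closure_induction (fun _ => id) ⟨0, circlePow_zero⟩ ?_ hx
  rintro - - - - ⟨m, rfl⟩ ⟨n, rfl⟩
  exact ⟨m + n, circlePow_add m n⟩

theorem laurentSubalgebra_separatesPoints : laurentSubalgebra.SeparatesPoints := by
  intro x y hxy
  refine ⟨_, ⟨circlePow 1, Algebra.subset_adjoin ⟨1, rfl⟩, rfl⟩, ?_⟩
  simpa [Circle.ext_iff] using hxy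

/-- Laurent polynomials are uniformly dense in the continuous functions. -/
theorem span_circlePow_dense :
    (Submodule.span ℂ (Set.range circlePow)).topologicalClosure = ⊤ := by
  rw [← laurentSubalgebra_coe]
  exact congr_arg (Subalgebra.toSubmodule <| StarSubalgebra.toSubalgebra ·)
    (ContinuousMap.starSubalgebra_topologicalClosure_eq_top_of_separatesPoints laurentSubalgebra
      laurentSubalgebra_separatesPoints)

/-- Continuous linear maps that agree on the monomials agree. -/
theorem clm_ext_circlePow {F : Type*} [NormedAddCommGroup F] [NormedSpace ℂ F]
    {S T : C(Circle, ℂ) →L[ℂ] F} (h : ∀ n, S (circlePow n) = T (circlePow n)) : S = T :=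
  ContinuousLinearMap.ext_on (Submodule.dense_iff_topologicalClosure_eq_top.mpr
    span_circlePow_dense) (by rintro _ ⟨n, rfl⟩; exact h n)

/-- Integration against a finite measure as a functional on continuous functions. -/
def integralCLM (μ : Measure Circle) [IsFiniteMeasure μ] : C(Circle, ℂ) →L[ℂ] ℂ :=
  LinearMap.mkContinuous
    { toFun := fun f => ∫ z, f z ∂μ
      map_add' := fun f g => integral_add
        (f.continuous.integrable_of_hasCompactSupport (HasCompactSupport.of_compactSpace f))
        (g.continuous.integrable_of_hasCompactSupport (HasCompactSupport.of_compactSpace g))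
      map_smul' := fun c f => integral_smul c f }
    (μ.real Set.univ) fun f => by
      rw [mul_comm]
      exact norm_integral_le_of_norm_le_const (ae_of_all _ f.norm_coe_le_norm)

@[simp] theorem integralCLM_apply (μ : Measure Circle) [IsFiniteMeasure μ] (f : C(Circle, ℂ)) :
    integralCLM μ f = ∫ z, f z ∂μ := rfl

/-- A finite measure on the circle is determined by its moments. -/
theorem measure_eq_of_moments {μ ν : Measure Circle} [IsFiniteMeasure μ] [IsFiniteMeasure ν]
    (h : ∀ n : ℤ, ∫ z : Circle, (z : ℂ) ^ n ∂μ = ∫ z : Circle, (z : ℂ) ^ n ∂ν) : μ = ν := by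
  have key : integralCLM μ = integralCLM ν := clm_ext_circlePow fun n => by simpa using h n
  refine ext_of_forall_integral_eq_of_IsFiniteMeasure fun f => ?_
  have := DFunLike.congr_fun key ⟨fun z => (f z : ℂ), by fun_prop⟩
  simp only [integralCLM_apply, ContinuousMap.coe_mk] at this
  exact_mod_cast this

/-! ### Functional calculus and existence of spectral measures. -/

section Calculus

variable {H : Type*} [NormedAddCommGroup H] [InnerProductSpace ℂ H]

theorem isometryEquiv_mul_apply (U V : H ≃ₗᵢ[ℂ] H) (x : H) : (U * V) x = U (V x) := rfl

theorem inner_zpow_left (U : H ≃ₗᵢ[ℂ] H) (n : ℤ) (x y : H) :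
    ⟪(U ^ n) x, y⟫_ℂ = ⟪x, (U ^ (-n)) y⟫_ℂ := by
  rw [← (U ^ (-n)).inner_map_map, ← isometryEquiv_mul_apply, ← zpow_add]
  simp

theorem IsSpectralMeasure.unique {U : H ≃ₗᵢ[ℂ] H} {φ : H} {μ ν : Measure Circle}
    (hμ : IsSpectralMeasure U φ μ) (hν : IsSpectralMeasure U φ ν) : μ = ν := by
  have := hμ.1
  have := hν.1
  exact measure_eq_of_moments fun n => (hμ.2 n).trans (hν.2 n).symm

variable [CompleteSpace H]

theorem coe_mem_unitary (U : H ≃ₗᵢ[ℂ] H) : (U : H →L[ℂ] H) ∈ unitary (H →L[ℂ] H) :=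
  (Unitary.linearIsometryEquiv.symm U).2

theorem spectrum_subset_circle (U : H ≃ₗᵢ[ℂ] H) (z : spectrum ℂ (U : H →L[ℂ] H)) :
    (z : ℂ) ∈ Submonoid.unitSphere ℂ :=
  spectrum.subset_circle_of_unitary (coe_mem_unitary U) z.2

theorem isStarNormal_coe (U : H ≃ₗᵢ[ℂ] H) : IsStarNormal (U : H →L[ℂ] H) :=
  ⟨by rw [Commute, SemiconjBy, (Unitary.mem_iff.mp (coe_mem_unitary U)).1,
    (Unitary.mem_iff.mp (coe_mem_unitary U)).2]⟩

/-- The continuous functional calculus of a unitary operator, for functions on the circle. -/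
def circleCalculus (U : H ≃ₗᵢ[ℂ] H) : C(Circle, ℂ) →⋆ₐ[ℂ] (H →L[ℂ] H) :=
  (cfcHom (R := ℂ) (isStarNormal_coe U)).comp <| ContinuousMap.compStarAlgHom' ℂ ℂ
    (⟨fun z => ⟨z, spectrum_subset_circle U z⟩,
      Continuous.subtype_mk continuous_subtype_val _⟩ : C(spectrum ℂ (U : H →L[ℂ] H), Circle))

theorem continuous_circleCalculus (U : H ≃ₗᵢ[ℂ] H) : Continuous (circleCalculus U) :=
  (cfcHom_continuous (isStarNormal_coe U)).comp (ContinuousMap.continuous_precomp _)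

theorem circleCalculus_one (U : H ≃ₗᵢ[ℂ] H) :
    circleCalculus U (circlePow 1) = (U : H →L[ℂ] H) := by
  rw [← cfcHom_id (R := ℂ) (isStarNormal_coe U)]
  simp only [circleCalculus, StarAlgHom.comp_apply]
  congr 1
  ext z
  rw [ContinuousMap.compStarAlgHom'_apply, ContinuousMap.comp_apply, circlePow_apply, zpow_one]
  rfl

theorem circleCalculus_pow_apply (U : H ≃ₗᵢ[ℂ] H) (n : ℤ) (x : H) :
    circleCalculus U (circlePow n) x = (U ^ n) x := by
  have key : ∀ n, circleCalculus U (circlePow (n + 1)) x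
      = U (circleCalculus U (circlePow n) x) := by
    intro n
    rw [add_comm, circlePow_add, map_mul, circleCalculus_one]
    rfl
  induction n using Int.induction_on with
  | zero => simp [circlePow_zero]
  | succ n ih => rw [key, ih, add_comm, zpow_add, zpow_one]; rfl
  | pred n ih =>
    have h := key (-n - 1)
    rw [sub_add_cancel, ih] at h
    apply U.injective
    rw [← h, ← isometryEquiv_mul_apply]
    congr 1
    rw [← zpow_one_add]
    simp

/-- `f ↦ f(U)x` as a continuous linear map. -/
def calculusVec (U : H ≃ₗᵢ[ℂ] H) (x : H) : C(Circle, ℂ) →L[ℂ] H where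
  toFun f := circleCalculus U f x
  map_add' f g := by simp
  map_smul' c f := by simp
  cont := (ContinuousLinearMap.apply ℂ H x).continuous.comp (continuous_circleCalculus U)

@[simp] theorem calculusVec_apply (U : H ≃ₗᵢ[ℂ] H) (x : H) (f : C(Circle, ℂ)) :
    calculusVec U x f = circleCalculus U f x := rfl

theorem norm_sq_circleCalculus (U : H ≃ₗᵢ[ℂ] H) (x : H) (f : C(Circle, ℂ)) :
    ((‖circleCalculus U f x‖ ^ 2 : ℝ) : ℂ) = ⟪x, circleCalculus U (star f * f) x⟫_ℂ := by
  rw [map_mul, map_star, mul_apply_eq_comp, ContinuousLinearMap.star_eq_adjoint,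
    ContinuousLinearMap.adjoint_inner_right, inner_self_eq_norm_sq_to_K]
  push_cast
  rfl

/-- The moments of a spectral measure determine the integrals of all continuous functions. -/
theorem IsSpectralMeasure.integral_eq {U : H ≃ₗᵢ[ℂ] H} {φ : H} {μ : Measure Circle}
    (hμ : IsSpectralMeasure U φ μ) (f : C(Circle, ℂ)) :
    ∫ z, f z ∂μ = ⟪φ, circleCalculus U f φ⟫_ℂ := by
  have := hμ.1
  have key : integralCLM μ = (innerSL ℂ φ).comp (calculusVec U φ) :=
    clm_ext_circlePow fun n => by simpa [circleCalculus_pow_apply] using hμ.2 n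
  exact DFunLike.congr_fun key f

/-- Riesz–Markov for the functional f ↦ Re ⟪φ, f(U)φ⟫ on real functions. It is positive because f ≥
0 is the square of g = √f, which gives ‖g(U)φ‖². -/
theorem exists_isSpectralMeasure (U : H ≃ₗᵢ[ℂ] H) (φ : H) :
    ∃ μ : Measure Circle, IsSpectralMeasure U φ μ := by
  let toC : C(Circle, ℝ) → C(Circle, ℂ) := fun f => ⟨fun z => (f z : ℂ), by fun_prop⟩
  let Λ₀ : CompactlySupportedContinuousMap Circle ℝ →ₗ[ℝ] ℝ :=
    { toFun := fun f => (⟪φ, circleCalculus U (toC f) φ⟫_ℂ).re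
      map_add' := fun f g => by
        have : toC ↑(f + g) = toC f + toC g := by ext z; simp [toC]
        rw [this, map_add, add_apply, inner_add_right, add_re]
      map_smul' := fun c f => by
        have : toC ↑(c • f) = (c : ℂ) • toC f := by ext z; simp [toC]
        rw [this, map_smul, smul_apply, inner_smul_right, re_ofReal_mul]
        rfl }
  have hpos : ∀ f, 0 ≤ f → 0 ≤ Λ₀ f := by
    intro f hf
    let g : C(Circle, ℂ) := ⟨fun z => (Real.sqrt (f z) : ℂ), by fun_prop⟩
    have hg : toC f = star g * g := by
      ext z
      simp only [toC, g, ContinuousMap.coe_mk, ContinuousMap.mul_apply, ContinuousMap.star_apply,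
        RCLike.star_def, conj_ofReal, ← ofReal_mul]
      rw [Real.mul_self_sqrt (hf z)]
    change 0 ≤ (⟪φ, circleCalculus U (toC f) φ⟫_ℂ).re
    rw [hg, ← norm_sq_circleCalculus, ofReal_re]
    positivity
  let Λ := PositiveLinearMap.mk₀ Λ₀ hpos
  refine ⟨RealRMK.rieszMeasure Λ, ?_⟩
  have hfin : IsFiniteMeasure (RealRMK.rieszMeasure Λ) := by infer_instance
  refine ⟨hfin, fun n => ?_⟩
  have hreal : ∀ f : C(Circle, ℝ), integralCLM (RealRMK.rieszMeasure Λ) (toC f)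
      = ⟪φ, circleCalculus U (toC f) φ⟫_ℂ := by
    intro f
    have h1 := RealRMK.integral_rieszMeasure Λ
      (CompactlySupportedContinuousMap.continuousMapEquiv f)
    -- A real function is fixed by `star`, so f(U) is self-adjoint and taking real parts lost
    -- nothing.
    have h2 : (⟪φ, circleCalculus U (toC f) φ⟫_ℂ).im = 0 := by
      rw [← conj_eq_iff_im, inner_conj_symm, ← ContinuousLinearMap.adjoint_inner_right,
        ← ContinuousLinearMap.star_eq_adjoint, ← map_star]
      congr 3
      ext z
      simp [toC]
    apply Complex.ext
    · have h3 : ∫ z, toC f z ∂(RealRMK.rieszMeasure Λ)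
          = ((∫ z, f z ∂(RealRMK.rieszMeasure Λ) : ℝ) : ℂ) := integral_ofReal
      rw [integralCLM_apply, h3, ofReal_re]
      exact h1
    · have h3 : ∫ z, toC f z ∂(RealRMK.rieszMeasure Λ)
          = ((∫ z, f z ∂(RealRMK.rieszMeasure Λ) : ℝ) : ℂ) := integral_ofReal
      rw [h2, integralCLM_apply, h3, ofReal_im]
  have hsplit : circlePow n = toC ⟨fun z => (circlePow n z).re, by fun_prop⟩
      + I • toC ⟨fun z => (circlePow n z).im, by fun_prop⟩ := by
    ext z
    simp only [ContinuousMap.add_apply, ContinuousMap.smul_apply, toC, ContinuousMap.coe_mk,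
      smul_eq_mul]
    rw [mul_comm, re_add_im]
  have : integralCLM (RealRMK.rieszMeasure Λ) (circlePow n)
      = ⟪φ, circleCalculus U (circlePow n) φ⟫_ℂ := by
    rw [hsplit, map_add, map_smul, hreal, hreal, map_add, map_smul,
      add_apply, smul_apply, inner_add_right,
      inner_smul_right, smul_eq_mul]
  simpa [circleCalculus_pow_apply] using this

end Calculus

/-! ### Cyclic subspaces and their models -/

section Cyclic

variable {H : Type*} [NormedAddCommGroup H] [InnerProductSpace ℂ H]

theorem zpow_apply_mem_cyclicSubspace (U : H ≃ₗᵢ[ℂ] H) (φ : H) (n : ℤ) :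
    (U ^ n) φ ∈ cyclicSubspace U φ :=
  Submodule.le_topologicalClosure _ (Submodule.subset_span ⟨n, rfl⟩)

theorem self_mem_cyclicSubspace (U : H ≃ₗᵢ[ℂ] H) (φ : H) : φ ∈ cyclicSubspace U φ := by
  simpa using zpow_apply_mem_cyclicSubspace U φ 0

theorem isClosed_cyclicSubspace (U : H ≃ₗᵢ[ℂ] H) (φ : H) :
    IsClosed (cyclicSubspace U φ : Set H) := Submodule.isClosed_topologicalClosure _

theorem cyclicSubspace_le {U : H ≃ₗᵢ[ℂ] H} {φ : H} {K : Submodule ℂ H}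
    (hK : IsClosed (K : Set H)) (h : ∀ n : ℤ, (U ^ n) φ ∈ K) : cyclicSubspace U φ ≤ K :=
  Submodule.topologicalClosure_minimal _
    (Submodule.span_le.mpr (by rintro _ ⟨n, rfl⟩; exact h n)) hK

theorem mem_cyclicSubspace_orthogonal {U : H ≃ₗᵢ[ℂ] H} {φ x : H} :
    x ∈ (cyclicSubspace U φ)ᗮ ↔ ∀ n : ℤ, ⟪(U ^ n) φ, x⟫_ℂ = 0 := by
  refine ⟨fun hx n => hx _ (zpow_apply_mem_cyclicSubspace U φ n), fun h => ?_⟩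
  have hle : cyclicSubspace U φ ≤ (Submodule.span ℂ {x})ᗮ :=
    cyclicSubspace_le (Submodule.isClosed_orthogonal _) fun n => by
      rw [Submodule.mem_orthogonal_singleton_iff_inner_left]
      exact h n
  intro u hu
  exact Submodule.mem_orthogonal_singleton_iff_inner_left.mp (hle hu)

theorem zpow_mem_cyclicSubspace {U : H ≃ₗᵢ[ℂ] H} {φ x : H} (hx : x ∈ cyclicSubspace U φ)
    (m : ℤ) : (U ^ m) x ∈ cyclicSubspace U φ := by
  have hle : cyclicSubspace U φ
      ≤ (cyclicSubspace U φ).comap ((U ^ m).toLinearEquiv : H →ₗ[ℂ] H) :=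
    cyclicSubspace_le ((isClosed_cyclicSubspace U φ).preimage (U ^ m).continuous) fun n => by
      change (U ^ m) ((U ^ n) φ) ∈ cyclicSubspace U φ
      rw [← isometryEquiv_mul_apply, ← zpow_add]
      exact zpow_apply_mem_cyclicSubspace U φ _
  exact hle hx

theorem zpow_mem_cyclicSubspace_orthogonal {U : H ≃ₗᵢ[ℂ] H} {φ x : H}
    (hx : x ∈ (cyclicSubspace U φ)ᗮ) (m : ℤ) : (U ^ m) x ∈ (cyclicSubspace U φ)ᗮ := by
  intro u hu
  rw [← neg_neg m, ← inner_zpow_left]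
  exact hx _ (zpow_mem_cyclicSubspace hu _)

theorem cyclicSubspace_le_orthogonal {U : H ≃ₗᵢ[ℂ] H} {x y : H}
    (h : ∀ n : ℤ, ⟪x, (U ^ n) y⟫_ℂ = 0) : cyclicSubspace U y ≤ (cyclicSubspace U x)ᗮ :=
  cyclicSubspace_le (Submodule.isClosed_orthogonal _) fun n =>
    mem_cyclicSubspace_orthogonal.mpr fun m => by
      rw [inner_zpow_left, ← isometryEquiv_mul_apply, ← zpow_add]
      exact h _

theorem IsSpectralMeasure.add {U : H ≃ₗᵢ[ℂ] H} {x y : H} {μ ν : Measure Circle}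
    (hμ : IsSpectralMeasure U x μ) (hν : IsSpectralMeasure U y ν)
    (h : ∀ n : ℤ, ⟪x, (U ^ n) y⟫_ℂ = 0) : IsSpectralMeasure U (x + y) (μ + ν) := by
  have := hμ.1
  have := hν.1
  refine ⟨inferInstance, fun n => ?_⟩
  have hint : ∀ κ : Measure Circle, IsFiniteMeasure κ →
      Integrable (fun z : Circle => (z : ℂ) ^ n) κ := fun κ _ => by
    simpa using! (circlePow n).continuous.integrable_of_hasCompactSupport (μ := κ)
      (HasCompactSupport.of_compactSpace _)
  have h' : ⟪y, (U ^ n) x⟫_ℂ = 0 := by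
    rw [← inner_conj_symm, inner_zpow_left, h, map_zero]
  rw [integral_add_measure (hint μ ‹_›) (hint ν ‹_›), hμ.2, hν.2, map_add, inner_add_left,
    inner_add_right, inner_add_right, h, h']
  ring

end Cyclic

/-- The measure `|f|² μ`. -/
def sqDensity (μ : Measure Circle) (f : Lp ℂ 2 μ) : Measure Circle :=
  μ.withDensity fun z => ‖f z‖ₑ ^ 2

theorem measurable_sqDensity {μ : Measure Circle} (f : Lp ℂ 2 μ) : Measurable fun z => ‖f z‖ₑ ^ 2 :=
  ((Lp.stronglyMeasurable f).measurable.enorm).pow_const 2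

theorem lintegral_sq_lt_top {μ : Measure Circle} (f : Lp ℂ 2 μ) : ∫⁻ z, ‖f z‖ₑ ^ 2 ∂μ < ⊤ := by
  have h := (Lp.memLp f).2
  rw [eLpNorm_lt_top_iff_lintegral_rpow_enorm_lt_top (by simp) (by simp)] at h
  simpa using h

instance {μ : Measure Circle} (f : Lp ℂ 2 μ) : IsFiniteMeasure (sqDensity μ f) :=
  isFiniteMeasure_withDensity (lintegral_sq_lt_top f).ne

theorem sqDensity_absolutelyContinuous {μ : Measure Circle} (f : Lp ℂ 2 μ) : sqDensity μ f ≪ μ :=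
  withDensity_absolutelyContinuous _ _

/-! ### The L² model of a cyclic subspace. -/

section Model

variable {H : Type*} [NormedAddCommGroup H] [InnerProductSpace ℂ H]

/-- `V` represents the cyclic subspace of `φ` as `L²(μ)`, with `U` acting as multiplication by
`z` and `φ` corresponding to the constant `1`. -/
def IsCyclicModel (U : H ≃ₗᵢ[ℂ] H) (φ : H) (μ : Measure Circle) [IsFiniteMeasure μ]
    (V : Lp ℂ 2 μ →ₗᵢ[ℂ] H) : Prop :=
  ∀ n : ℤ, V (ContinuousMap.toLp 2 μ ℂ (circlePow n)) = (U ^ n) φ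

/-- Since ‖f(U)φ‖² = ∫ |f|² dμ, the map f ↦ f(U)φ is isometric for the L² norm on continuous
functions, which are dense; V is its extension. -/
theorem exists_isCyclicModel [CompleteSpace H] {U : H ≃ₗᵢ[ℂ] H} {φ : H} {μ : Measure Circle}
    [IsFiniteMeasure μ] (hμ : IsSpectralMeasure U φ μ) :
    ∃ V : Lp ℂ 2 μ →ₗᵢ[ℂ] H, IsCyclicModel U φ μ V := by
  let e := (ContinuousMap.toLp (E := ℂ) 2 μ ℂ).toLinearMap
  let f := (calculusVec U φ).toLinearMap
  have hd : DenseRange e := ContinuousMap.toLp_denseRange ℂ μ ℂ (by simp)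
  have hn : ∀ g, ‖f g‖ = ‖e g‖ := by
    intro g
    rw [← sq_eq_sq₀ (norm_nonneg _) (norm_nonneg _), ← ofReal_inj]
    rw [show f g = circleCalculus U g φ from rfl, norm_sq_circleCalculus, ← hμ.integral_eq,
      ofReal_pow, ← coe_algebraMap, ← inner_self_eq_norm_sq_to_K (𝕜 := ℂ)]
    exact (integral_congr_ae (ae_of_all _ fun z => mul_comm _ _)).trans
      (ContinuousMap.inner_toLp μ g g).symm
  have hb : ∀ g, ‖f g‖ ≤ 1 * ‖e g‖ := fun g => by rw [one_mul, hn]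
  have he := LinearMap.extendOfNorm_eq hd ⟨1, hb⟩
  refine ⟨⟨(f.extendOfNorm e).toLinearMap, fun x => ?_⟩, fun n => ?_⟩
  · refine hd.induction (P := fun x => ‖f.extendOfNorm e x‖ = ‖x‖) ?_
      (isClosed_eq (by fun_prop) (by fun_prop)) x
    rintro _ ⟨g, rfl⟩
    rw [he, hn]
  · exact (he _).trans (circleCalculus_pow_apply U n φ)

variable {U : H ≃ₗᵢ[ℂ] H} {φ : H} {μ : Measure Circle} [IsFiniteMeasure μ]
  {V : Lp ℂ 2 μ →ₗᵢ[ℂ] H}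

theorem span_toLp_circlePow_dense (μ : Measure Circle) [IsFiniteMeasure μ] :
    (Submodule.span ℂ (Set.range fun n : ℤ =>
      ContinuousMap.toLp (E := ℂ) 2 μ ℂ (circlePow n))).topologicalClosure = ⊤ := by
  have := (ContinuousMap.toLp_denseRange ℂ μ ℂ (p := 2) (by simp)).topologicalClosure_map_submodule
    span_circlePow_dense
  rw [Submodule.map_span, ← Set.range_comp] at this
  exact this

theorem clm_ext_toLp_circlePow {F : Type*} [NormedAddCommGroup F] [NormedSpace ℂ F]
    {S T : Lp ℂ 2 μ →L[ℂ] F} (h : ∀ n, S (ContinuousMap.toLp 2 μ ℂ (circlePow n))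
      = T (ContinuousMap.toLp 2 μ ℂ (circlePow n))) : S = T :=
  ContinuousLinearMap.ext_on (Submodule.dense_iff_topologicalClosure_eq_top.mpr
    (span_toLp_circlePow_dense μ)) (by rintro _ ⟨n, rfl⟩; exact h n)

/-- A function in `L²` that is orthogonal to all monomials vanishes. -/
theorem eq_zero_of_inner_circlePow {f : Lp ℂ 2 μ}
    (h : ∀ n, ⟪f, ContinuousMap.toLp 2 μ ℂ (circlePow n)⟫_ℂ = 0) : f = 0 := by
  have : innerSL ℂ f = 0 := clm_ext_toLp_circlePow fun n => by simpa using h n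
  exact inner_self_eq_zero.mp (DFunLike.congr_fun this f)

theorem IsCyclicModel.mem_cyclicSubspace (hV : IsCyclicModel U φ μ V) (f : Lp ℂ 2 μ) :
    V f ∈ cyclicSubspace U φ := by
  have hle : (Submodule.span ℂ (Set.range fun n : ℤ =>
      ContinuousMap.toLp (E := ℂ) 2 μ ℂ (circlePow n))).topologicalClosure
      ≤ (cyclicSubspace U φ).comap V.toLinearMap := by
    refine Submodule.topologicalClosure_minimal _ (Submodule.span_le.mpr ?_)
      ((isClosed_cyclicSubspace U φ).preimage V.continuous)
    rintro _ ⟨n, rfl⟩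
    change V (ContinuousMap.toLp 2 μ ℂ (circlePow n)) ∈ cyclicSubspace U φ
    rw [hV n]
    exact zpow_apply_mem_cyclicSubspace U φ n
  exact hle (span_toLp_circlePow_dense μ ▸ Submodule.mem_top)

theorem IsCyclicModel.exists_eq (hV : IsCyclicModel U φ μ V) {x : H}
    (hx : x ∈ cyclicSubspace U φ) : ∃ f, V f = x := by
  have hle : cyclicSubspace U φ ≤ V.range := by
    refine cyclicSubspace_le ?_ fun n => ⟨_, hV n⟩
    exact V.isometry.isClosedEmbedding.isClosed_range
  exact hle hx

/-- Multiplication by `zⁿ` on `L²(μ)`. -/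
def mulPow (μ : Measure Circle) [IsFiniteMeasure μ] (n : ℤ) : Lp ℂ 2 μ →L[ℂ] Lp ℂ 2 μ :=
  (ContinuousLinearMap.mul ℂ ℂ).holderL μ ⊤ 2 2 (ContinuousMap.toLp ⊤ μ ℂ (circlePow n))

theorem coeFn_mulPow (n : ℤ) (f : Lp ℂ 2 μ) :
    mulPow μ n f =ᵐ[μ] fun z => (z : ℂ) ^ n * f z := by
  filter_upwards [(ContinuousLinearMap.mul ℂ ℂ).coeFn_holder (r := 2)
    (ContinuousMap.toLp (E := ℂ) ⊤ μ ℂ (circlePow n)) f,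
    ContinuousMap.coeFn_toLp (p := ⊤) (𝕜 := ℂ) μ (circlePow n)] with z h1 h2
  simp only [mulPow, ContinuousLinearMap.holderL_apply_apply]
  rw [h1, h2]
  simp

theorem IsCyclicModel.map_mulPow (hV : IsCyclicModel U φ μ V) (n : ℤ) (f : Lp ℂ 2 μ) :
    V (mulPow μ n f) = (U ^ n) (V f) := by
  have : V.toContinuousLinearMap.comp (mulPow μ n)
      = ((U ^ n).toContinuousLinearEquiv : H →L[ℂ] H).comp V.toContinuousLinearMap := by
    refine clm_ext_toLp_circlePow fun m => ?_
    have hm : mulPow μ n (ContinuousMap.toLp 2 μ ℂ (circlePow m))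
        = ContinuousMap.toLp 2 μ ℂ (circlePow (n + m)) := by
      refine Lp.ext ?_
      filter_upwards [coeFn_mulPow n (ContinuousMap.toLp (E := ℂ) 2 μ ℂ (circlePow m)),
        ContinuousMap.coeFn_toLp (p := 2) (𝕜 := ℂ) μ (circlePow m),
        ContinuousMap.coeFn_toLp (p := 2) (𝕜 := ℂ) μ (circlePow (n + m))] with z h1 h2 h3
      rw [h1, h2, h3, circlePow_add]
      simp
    change V (mulPow μ n _) = (U ^ n) (V _)
    rw [hm, hV, hV, zpow_add]
    rfl
  exact DFunLike.congr_fun this f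

theorem IsCyclicModel.isSpectralMeasure (hV : IsCyclicModel U φ μ V) (f : Lp ℂ 2 μ) :
    IsSpectralMeasure U (V f) (sqDensity μ f) := by
  refine ⟨inferInstance, fun n => ?_⟩
  rw [← hV.map_mulPow, V.inner_map_map, L2.inner_def, sqDensity,
    integral_withDensity_eq_integral_toReal_smul (measurable_sqDensity f)
      (ae_of_all _ fun z => by finiteness)]
  refine integral_congr_ae ?_
  filter_upwards [coeFn_mulPow n f] with z hz
  rw [hz]
  simp only [RCLike.inner_apply, ENNReal.toReal_pow, toReal_enorm, real_smul]
  rw [mul_assoc, mul_conj, normSq_eq_norm_sq]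
  ring

end Model

/-! ### Boundary growth at singular points -/

/-- The function `z ↦ ∫ (1 - z ζ̄)⁻¹ dμ(ζ)` on the unit disc. -/
def cauchyTransform (μ : Measure Circle) (z : ℂ) : ℂ :=
  ∫ ζ : Circle, (1 - z * conj (ζ : ℂ))⁻¹ ∂μ

theorem one_sub_mul_conj_ne_zero {z : ℂ} (hz : ‖z‖ < 1) (ζ : Circle) :
    1 - z * conj (ζ : ℂ) ≠ 0 := by
  intro h
  have : ‖z * conj (ζ : ℂ)‖ = 1 := by rw [← sub_eq_zero.mp h, norm_one]
  rw [norm_mul, norm_conj, Circle.norm_coe, mul_one] at this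
  linarith

/-- The Cauchy kernel as a continuous function on the circle. -/
def cauchyKernel (z : ℂ) (hz : ‖z‖ < 1) : C(Circle, ℂ) :=
  ⟨fun ζ => (1 - z * conj (ζ : ℂ))⁻¹,
    Continuous.inv₀ (by fun_prop) (one_sub_mul_conj_ne_zero hz)⟩

theorem re_inv_one_sub_nonneg {w : ℂ} (hw : ‖w‖ < 1) : 0 ≤ ((1 - w)⁻¹).re := by
  rw [inv_re]
  refine div_nonneg ?_ (normSq_nonneg _)
  have := (abs_le.mp (abs_re_le_norm w)).2
  simp only [sub_re, one_re]
  linarith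

/-- With w = rξζ̄, one has Re(1 - w) ≥ 1 - r and |1 - w| ≤ |ζ - ξ| + (1 - r) ≤ 2(1 - r); divide the
first by the square of the second. -/
theorem le_re_cauchyKernel {r : ℝ} (hr0 : 0 ≤ r) (hr : r < 1) {ξ ζ : Circle}
    (h : dist ζ ξ ≤ 1 - r) :
    1 / (4 * (1 - r)) ≤ ((1 - (r * (ξ : ℂ)) * conj (ζ : ℂ))⁻¹).re := by
  set w : ℂ := (r * (ξ : ℂ)) * conj (ζ : ℂ) with hw
  have hwn : ‖w‖ = r := by
    simp [hw, abs_of_nonneg hr0, Circle.norm_coe]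
  have hre : w.re ≤ r := hwn ▸ (abs_le.mp (abs_re_le_norm w)).2
  have h1 : ‖1 - w‖ ≤ 2 * (1 - r) := by
    have e : 1 - w = conj (ζ : ℂ) * (((ζ : ℂ) - ξ) + ((1 - r : ℝ) : ℂ) * ξ) := by
      have : conj (ζ : ℂ) * ζ = 1 := by
        rw [mul_comm, mul_conj, normSq_eq_norm_sq, Circle.norm_coe]; simp
      rw [hw]
      push_cast
      linear_combination -this
    have h2 : ‖(ζ : ℂ) - ξ‖ ≤ 1 - r := by rw [← dist_eq_norm]; exact h
    rw [e, norm_mul, norm_conj, Circle.norm_coe, one_mul]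
    refine (norm_add_le _ _).trans ?_
    rw [norm_mul, Circle.norm_coe, mul_one, norm_real, Real.norm_of_nonneg (by linarith)]
    linarith
  have h0 : 1 - r ≤ ‖1 - w‖ := by
    have := norm_sub_norm_le 1 w
    rw [norm_one, hwn] at this
    exact this
  rw [inv_re, normSq_eq_norm_sq, div_le_div_iff₀ (by linarith) (by nlinarith)]
  simp only [sub_re, one_re]
  nlinarith

/-- The kernel has nonnegative real part, so only its lower bound on the ball is kept. -/
theorem measureReal_closedBall_le {κ μ : Measure Circle} [IsFiniteMeasure μ] (hκ : κ ≤ μ)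
    {r : ℝ} (hr0 : 0 ≤ r) (hr : r < 1) (ξ : Circle) :
    κ.real (Metric.closedBall ξ (1 - r)) / (4 * (1 - r))
      ≤ (cauchyTransform μ (r * (ξ : ℂ))).re := by
  have hz : ‖(r * (ξ : ℂ) : ℂ)‖ < 1 := by
    simpa [abs_of_nonneg hr0, Circle.norm_coe] using hr
  set k := cauchyKernel _ hz
  have hint : Integrable k μ :=
    k.continuous.integrable_of_hasCompactSupport (HasCompactSupport.of_compactSpace _)
  have hre : (cauchyTransform μ (r * (ξ : ℂ))).re = ∫ ζ, (k ζ).re ∂μ :=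
    (integral_re hint).symm
  have hnn : ∀ ζ, 0 ≤ (k ζ).re := fun ζ => re_inv_one_sub_nonneg (by
    rw [norm_mul, norm_conj, Circle.norm_coe, mul_one]; exact hz)
  rw [hre]
  calc κ.real (Metric.closedBall ξ (1 - r)) / (4 * (1 - r))
      ≤ μ.real (Metric.closedBall ξ (1 - r)) / (4 * (1 - r)) := by
        have : 0 < 4 * (1 - r) := by linarith
        gcongr
        exact ENNReal.toReal_mono (measure_ne_top _ _) (hκ _)
    _ = ∫ _ in Metric.closedBall ξ (1 - r), 1 / (4 * (1 - r)) ∂μ := by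
        rw [setIntegral_const, smul_eq_mul]; ring
    _ ≤ ∫ ζ in Metric.closedBall ξ (1 - r), (k ζ).re ∂μ :=
        setIntegral_mono_on (integrable_const _).integrableOn hint.re.integrableOn
          Metric.isClosed_closedBall.measurableSet
          fun ζ hζ => le_re_cauchyKernel hr0 hr hζ
    _ ≤ ∫ ζ, (k ζ).re ∂μ := setIntegral_le_integral hint.re (ae_of_all _ hnn)

instance : IsFiniteMeasure arcLength := by
  unfold arcLength; infer_instance

theorem dist_circleExp_le (s t : ℝ) : dist (Circle.exp s) (Circle.exp t) ≤ |s - t| := by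
  have h : (Circle.exp s : ℂ) - Circle.exp t
      = Circle.exp t * (Complex.exp (I * ((s - t : ℝ) : ℂ)) - 1) := by
    rw [mul_sub, mul_one, Circle.coe_exp, Circle.coe_exp, ← Complex.exp_add]
    congr 2
    push_cast
    ring
  change dist (Circle.exp s : ℂ) (Circle.exp t) ≤ _
  rw [dist_eq_norm, h, norm_mul, Circle.norm_coe, one_mul]
  exact Real.norm_exp_I_mul_ofReal_sub_one_le

theorem ofReal_le_arcLength_closedBall (ξ : Circle) {h : ℝ} (h1 : h ≤ 1) :
    ENNReal.ofReal h ≤ arcLength (Metric.closedBall ξ h) := by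
  rw [arcLength, Measure.map_apply Circle.exp.continuous.measurable
    Metric.isClosed_closedBall.measurableSet, Measure.restrict_apply
    (Circle.exp.continuous.measurable Metric.isClosed_closedBall.measurableSet)]
  have hπ := Real.pi_gt_three
  have hm := Complex.arg_mem_Ioc (ξ : ℂ)
  have hdist : ∀ s : ℝ, |s - arg (ξ : ℂ)| ≤ h → s ∈ Circle.exp ⁻¹' Metric.closedBall ξ h := by
    intro s hs
    have := dist_circleExp_le s (arg (ξ : ℂ))
    rw [Circle.exp_arg] at this
    exact this.trans hs
  -- An interval of length h running from the argument towards 0 stays inside (-π, π], so no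
  -- wrap-around occurs.
  rcases le_total 0 (arg (ξ : ℂ)) with h0 | h0
  · calc ENNReal.ofReal h = volume (Set.Ioc (arg (ξ : ℂ) - h) (arg (ξ : ℂ))) := by
          rw [Real.volume_Ioc]; congr 1; ring
      _ ≤ volume (Circle.exp ⁻¹' Metric.closedBall ξ h ∩ Set.Ioc (-Real.pi) Real.pi) :=
        measure_mono fun s hs => ⟨hdist s (abs_le.mpr ⟨by linarith [hs.1],
          by linarith [hs.1, hs.2]⟩), by linarith [hs.1], hs.2.trans hm.2⟩
  · calc ENNReal.ofReal h = volume (Set.Ioc (arg (ξ : ℂ)) (arg (ξ : ℂ) + h)) := by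
          rw [Real.volume_Ioc]; congr 1; ring
      _ ≤ volume (Circle.exp ⁻¹' Metric.closedBall ξ h ∩ Set.Ioc (-Real.pi) Real.pi) :=
        measure_mono fun s hs => ⟨hdist s (abs_le.mpr ⟨by linarith [hs.1, hs.2],
          by linarith [hs.2]⟩), hm.1.trans hs.1, by linarith [hs.2]⟩

/-- Density of arc length with respect to a singular measure vanishes almost everywhere. -/
theorem ae_tendsto_arcLength_div {κ : Measure Circle} [IsFiniteMeasure κ]
    (hs : κ ⟂ₘ arcLength) :
    ∀ᵐ ξ ∂κ, Tendsto (fun h => arcLength (Metric.closedBall ξ h) / κ (Metric.closedBall ξ h))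
      (𝓝[>] 0) (𝓝 0) := by
  -- Besicovitch differentiation is applied in the plane. The inclusion is isometric, so planar
  -- balls pull back to balls of the circle.
  let c : Circle → ℂ := fun z => z
  have hemb : MeasurableEmbedding c :=
    (Isometry.isClosedEmbedding (f := c) fun _ _ => rfl).measurableEmbedding
  have hs' : arcLength.map c ⟂ₘ κ.map c := by
    obtain ⟨s, hsm, h1, h2⟩ := hs.symm
    refine Measure.MutuallySingular.mk (s := c '' s) (t := (c '' s)ᶜ) ?_ ?_ (by simp)
    · rw [hemb.map_apply, Set.preimage_image_eq _ hemb.injective, h1]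
    · rw [hemb.map_apply, Set.preimage_compl, Set.preimage_image_eq _ hemb.injective, h2]
  have h := Besicovitch.ae_tendsto_rnDeriv (arcLength.map c)
    (κ.map c)
  have h0 := (Measure.rnDeriv_eq_zero _ _).mpr hs'
  have h' := h.and h0
  rw [hemb.ae_map_iff] at h'
  filter_upwards [h'] with ξ hξ
  rw [hξ.2] at hξ
  refine hξ.1.congr fun r => ?_
  rw [hemb.map_apply, hemb.map_apply]
  rfl

/-- The real part of the Cauchy transform of `μ` tends to infinity almost everywhere with respect
to any singular measure below `μ`. -/
theorem ae_tendsto_re_cauchyTransform {κ μ : Measure Circle} [IsFiniteMeasure μ] (hκ : κ ≤ μ)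
    (hs : κ ⟂ₘ arcLength) :
    ∀ᵐ ξ : Circle ∂κ, Tendsto (fun r : ℝ => (cauchyTransform μ (r * (ξ : ℂ))).re) (𝓝[<] 1) atTop := by
  have : IsFiniteMeasure κ := isFiniteMeasure_of_le μ hκ
  filter_upwards [ae_tendsto_arcLength_div hs] with ξ hξ
  have hmap : Tendsto (fun r : ℝ => 1 - r) (𝓝[<] 1) (𝓝[>] 0) := by
    refine tendsto_nhdsWithin_iff.mpr ⟨?_, ?_⟩
    · have : Tendsto (fun r : ℝ => 1 - r) (𝓝 1) (𝓝 (1 - 1)) := by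
        exact Continuous.tendsto (by fun_prop) 1
      rw [sub_self] at this
      exact this.mono_left nhdsWithin_le_nhds
    · filter_upwards [self_mem_nhdsWithin] with r hr
      exact sub_pos.mpr (Set.mem_Iio.mp hr)
  refine tendsto_atTop.mpr fun b => ?_
  -- The density bound 1/(4M) gives κ(ball) ≥ 4M(1 - r), which cancels the factor 4(1 - r) and
  -- leaves M ≥ b; the 1 keeps M positive.
  set M : ℝ := max b 1 with hM
  have hMpos : 0 < M := lt_of_lt_of_le one_pos (le_max_right _ _)
  have hev := (hξ.comp hmap).eventually_le_const
    (u := ENNReal.ofReal (1 / (4 * M))) (by positivity)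
  filter_upwards [hev, Ioo_mem_nhdsLT (show (0 : ℝ) < 1 by norm_num)] with r hr hr1
  have hr : arcLength (Metric.closedBall ξ (1 - r)) / κ (Metric.closedBall ξ (1 - r))
      ≤ ENNReal.ofReal (1 / (4 * M)) := hr
  rw [ENNReal.div_le_iff_le_mul (Or.inr ENNReal.ofReal_ne_top)
    (Or.inl (measure_ne_top _ _))] at hr
  have h2 := (ofReal_le_arcLength_closedBall ξ (h := 1 - r) (by linarith [hr1.1])).trans hr
  rw [← ofReal_measureReal, ← ENNReal.ofReal_mul (by positivity),
    ENNReal.ofReal_le_ofReal_iff (by positivity)] at h2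
  refine le_trans ?_ (measureReal_closedBall_le hκ hr1.1.le hr1.2 ξ)
  refine (le_max_left b 1).trans ?_
  rw [le_div_iff₀ (by linarith [hr1.2])]
  rw [div_mul_eq_mul_div, one_mul, le_div_iff₀ (by positivity)] at h2
  linarith

theorem reflection_singleton_orthogonal_apply {H : Type*} [NormedAddCommGroup H]
    [InnerProductSpace ℂ H] {φ : H} (y : H) :
    (Submodule.span ℂ {φ})ᗮ.reflection y
      = y - (2 * (⟪φ, y⟫_ℂ / ((‖φ‖ ^ 2 : ℝ) : ℂ))) • φ := by
  rw [Submodule.reflection_orthogonal_apply, Submodule.reflection_singleton_apply, neg_sub,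
    mul_smul, two_smul, two_smul]
  push_cast
  rfl

theorem eq_of_sub_smul_eq {H : Type*} [NormedAddCommGroup H] [InnerProductSpace ℂ H]
    {U : H ≃ₗᵢ[ℂ] H} {z : ℂ} (hz : ‖z‖ < 1) {x y : H}
    (h : x - z • U x = y - z • U y) : x = y := by
  have h1 : x - y = z • U (x - y) := by
    rw [map_sub, smul_sub]
    linear_combination (norm := module) h
  have h2 := congrArg norm h1
  rw [norm_smul, U.norm_map] at h2
  have h3 : ‖x - y‖ = 0 := by nlinarith [norm_nonneg (x - y)]
  exact sub_eq_zero.mp (norm_eq_zero.mp h3)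

/-! ### Rank-one perturbation and Aronszajn–Donoghue theory. -/

section RankOne

variable {H : Type*} [NormedAddCommGroup H] [InnerProductSpace ℂ H] [CompleteSpace H]

/-- The vector is (1 - zU⁻¹)⁻¹φ: on the circle ζ̄ = ζ⁻¹, so the Cauchy kernel inverts 1 - zζ⁻¹ in
the functional calculus. -/
theorem exists_resolvent_vector {U : H ≃ₗᵢ[ℂ] H} {φ : H} {μ : Measure Circle}
    (hμ : IsSpectralMeasure U φ μ) {z : ℂ} (hz : ‖z‖ < 1) :
    ∃ x, x - z • U.symm x = φ ∧ ⟪φ, x⟫_ℂ = cauchyTransform μ z := by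
  refine ⟨circleCalculus U (cauchyKernel z hz) φ, ?_, (hμ.integral_eq _).symm⟩
  have h1 : (1 - z • circlePow (-1)) * cauchyKernel z hz = 1 := by
    ext ζ
    simp only [ContinuousMap.mul_apply, ContinuousMap.sub_apply, ContinuousMap.one_apply,
      ContinuousMap.smul_apply, smul_eq_mul, circlePow_apply, cauchyKernel, ContinuousMap.coe_mk]
    rw [zpow_neg_one, ← Circle.coe_inv, Circle.coe_inv_eq_conj]
    exact mul_inv_cancel₀ (one_sub_mul_conj_ne_zero hz ζ)
  have h2 := congrArg (fun T => circleCalculus U T φ) h1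
  simp only [map_mul, map_sub, map_one, map_smul, mul_apply_eq_comp, sub_apply, smul_apply,
    circleCalculus_pow_apply, zpow_neg_one] at h2
  exact h2

/-- The Aronszajn–Krein formula for the perturbation of a unitary operator by a reflection. -/
theorem cauchyTransform_reflection {U : H ≃ₗᵢ[ℂ] H} {φ : H} (hφ : φ ≠ 0) {μ ν : Measure Circle}
    (hμ : IsSpectralMeasure U φ μ)
    (hν : IsSpectralMeasure (U * (Submodule.span ℂ {φ})ᗮ.reflection) φ ν)
    {z : ℂ} (hz : ‖z‖ < 1) :
    ((‖φ‖ ^ 2 : ℝ) : ℂ) * (cauchyTransform μ z + cauchyTransform ν z)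
      = 2 * (cauchyTransform μ z * cauchyTransform ν z) := by
  obtain ⟨x, hx, hgx⟩ := exists_resolvent_vector hμ hz
  obtain ⟨x', hx', hgx'⟩ := exists_resolvent_vector hν hz
  set R := (Submodule.span ℂ {φ})ᗮ.reflection with hR
  set N : ℂ := ((‖φ‖ ^ 2 : ℝ) : ℂ) with hN
  have hN0 : N ≠ 0 := by simpa [hN] using hφ
  have hNφ : ⟪φ, φ⟫_ℂ = N := by rw [inner_self_eq_norm_sq_to_K, hN]; push_cast; rfl
  have hsymm : ∀ y, (U * R).symm y = R (U.symm y) := fun y => rfl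
  have hA : ∀ y, (U * R).symm y = U.symm y - (2 * (⟪φ, U.symm y⟫_ℂ / N)) • φ := fun y => by
    rw [hsymm, hR, reflection_singleton_orthogonal_apply]
  set t := ⟪φ, U.symm x⟫_ℂ with ht
  -- (UR)⁻¹ differs from U⁻¹ by a map into the span of φ, so the two resolvent vectors are
  -- proportional.
  have h1 : x - z • (U * R).symm x = (1 + 2 * z * t / N) • φ := by
    rw [hA, ← ht, smul_sub, smul_smul]
    linear_combination (norm := module) hx
  have h2 : x = (1 + 2 * z * t / N) • x' := by
    refine eq_of_sub_smul_eq (U := (U * R).symm) hz ?_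
    rw [h1, map_smul, ← hx']
    module
  have h3 : N = cauchyTransform μ z - z * t := by
    rw [← hNφ, ← hgx, ht, ← inner_smul_right, ← inner_sub_right, hx]
  have h4 : cauchyTransform μ z = (1 + 2 * z * t / N) * cauchyTransform ν z := by
    rw [← hgx, ← hgx', ← inner_smul_right, ← h2]
  have h5 : N * cauchyTransform μ z = (N + 2 * (z * t)) * cauchyTransform ν z := by
    rw [h4]
    field_simp
  linear_combination h5 + 2 * cauchyTransform ν z * h3

/-- Singular parts of the spectral measures of a unitary operator and of its perturbation by a
reflection are mutually singular (Aronszajn–Donoghue). -/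
theorem mutuallySingular_of_reflection {U : H ≃ₗᵢ[ℂ] H} {φ : H} (hφ : φ ≠ 0)
    {μ ν κ κ' : Measure Circle} (hμ : IsSpectralMeasure U φ μ)
    (hν : IsSpectralMeasure (U * (Submodule.span ℂ {φ})ᗮ.reflection) φ ν)
    (hκ : κ ≤ μ) (hκ' : κ' ≤ ν) (hs : κ ⟂ₘ arcLength) (hs' : κ' ⟂ₘ arcLength) : κ ⟂ₘ κ' := by
  have := hμ.1
  have := hν.1
  have e1 := ae_iff.mp (ae_tendsto_re_cauchyTransform hκ hs)
  have e2 := ae_iff.mp (ae_tendsto_re_cauchyTransform hκ' hs')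
  -- The exceptional sets cover the circle: the Krein formula reads 1/g + 1/g' = 2/‖φ‖², which fails
  -- once |g| and |g'| both exceed ‖φ‖².
  refine Measure.MutuallySingular.mk e1 e2 fun ξ _ => ?_
  by_contra! hcon
  simp only [Set.mem_union, Set.mem_ofPred_eq, not_or, not_not] at hcon
  obtain ⟨r, h1, h2, hr⟩ := ((hcon.1.eventually (eventually_gt_atTop (‖φ‖ ^ 2))).and
    ((hcon.2.eventually (eventually_gt_atTop (‖φ‖ ^ 2))).and
      (Ioo_mem_nhdsLT (show (0 : ℝ) < 1 by norm_num)))).exists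
  have hz : ‖(r * (ξ : ℂ) : ℂ)‖ < 1 := by
    simpa [abs_of_pos hr.1, Circle.norm_coe] using hr.2
  have key := congrArg norm (cauchyTransform_reflection hφ hμ hν hz)
  have hp : 0 < ‖φ‖ ^ 2 := by positivity
  set g := cauchyTransform μ (r * (ξ : ℂ))
  set g' := cauchyTransform ν (r * (ξ : ℂ))
  have h3 := h1.trans_le (re_le_norm g)
  have h4 := h2.trans_le (re_le_norm g')
  rw [norm_mul, norm_mul, norm_mul, norm_real, Real.norm_of_nonneg hp.le] at key
  have h5 := norm_add_le g g'
  norm_num at key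
  nlinarith [mul_le_mul_of_nonneg_left h5 hp.le]

end RankOne

/-! ### Orthogonal cyclic pairs -/

section Abstract

variable {H : Type*} [NormedAddCommGroup H] [InnerProductSpace ℂ H]

/-- The cyclic subspaces of `φ` and `η` are orthogonal and together span a dense subspace. -/
structure IsOrthogonalCyclicPair (U : H ≃ₗᵢ[ℂ] H) (φ η : H) : Prop where
  inner_eq_zero : ∀ n : ℤ, ⟪φ, (U ^ n) η⟫_ℂ = 0
  eq_zero : ∀ x, x ∈ (cyclicSubspace U φ)ᗮ → x ∈ (cyclicSubspace U η)ᗮ → x = 0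

instance [CompleteSpace H] (U : H ≃ₗᵢ[ℂ] H) (φ : H) : CompleteSpace (cyclicSubspace U φ) :=
  (isClosed_cyclicSubspace U φ).completeSpace_coe

section Pair

variable {U : H ≃ₗᵢ[ℂ] H} {φ η : H} {μ₁ μ₂ : Measure Circle} [IsFiniteMeasure μ₁]
  [IsFiniteMeasure μ₂] {V₁ : Lp ℂ 2 μ₁ →ₗᵢ[ℂ] H} {V₂ : Lp ℂ 2 μ₂ →ₗᵢ[ℂ] H}

theorem IsOrthogonalCyclicPair.inner_model (h : IsOrthogonalCyclicPair U φ η)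
    (h₁ : IsCyclicModel U φ μ₁ V₁) (h₂ : IsCyclicModel U η μ₂ V₂) (f : Lp ℂ 2 μ₁)
    (g : Lp ℂ 2 μ₂) : ⟪V₁ f, V₂ g⟫_ℂ = 0 :=
  cyclicSubspace_le_orthogonal h.inner_eq_zero (h₂.mem_cyclicSubspace g) _
    (h₁.mem_cyclicSubspace f)

theorem IsOrthogonalCyclicPair.inner_add_add (h : IsOrthogonalCyclicPair U φ η)
    (h₁ : IsCyclicModel U φ μ₁ V₁) (h₂ : IsCyclicModel U η μ₂ V₂) (f f' : Lp ℂ 2 μ₁)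
    (g g' : Lp ℂ 2 μ₂) : ⟪V₁ f + V₂ g, V₁ f' + V₂ g'⟫_ℂ = ⟪f, f'⟫_ℂ + ⟪g, g'⟫_ℂ := by
  have h' : ⟪V₂ g, V₁ f'⟫_ℂ = 0 := by rw [← inner_conj_symm, h.inner_model h₁ h₂, map_zero]
  rw [inner_add_left, inner_add_right, inner_add_right, h.inner_model h₁ h₂, h',
    V₁.inner_map_map, V₂.inner_map_map]
  ring

/-- Subtracting both orthogonal projections from x leaves a vector orthogonal to both cyclic
subspaces, hence 0. -/
theorem IsOrthogonalCyclicPair.exists_eq_add [CompleteSpace H]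
    (h : IsOrthogonalCyclicPair U φ η)
    (h₁ : IsCyclicModel U φ μ₁ V₁) (h₂ : IsCyclicModel U η μ₂ V₂) (x : H) :
    ∃ f g, x = V₁ f + V₂ g := by
  set C := cyclicSubspace U φ
  set D := cyclicSubspace U η
  have hDC : D ≤ Cᗮ := cyclicSubspace_le_orthogonal h.inner_eq_zero
  obtain ⟨f, hf⟩ := h₁.exists_eq (x := C.starProjection x) (C.starProjection_apply_mem x)
  obtain ⟨g, hg⟩ := h₂.exists_eq (x := D.starProjection x) (D.starProjection_apply_mem x)
  refine ⟨f, g, ?_⟩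
  rw [hf, hg]
  have h0 : x - C.starProjection x - D.starProjection x = 0 := by
    refine h.eq_zero _ ?_ ?_
    · exact sub_mem (C.sub_starProjection_mem_orthogonal x)
        (hDC (D.starProjection_apply_mem x))
    · rw [sub_right_comm]
      refine sub_mem (D.sub_starProjection_mem_orthogonal x) ?_
      intro u hu
      rw [← inner_conj_symm, hDC hu _ (C.starProjection_apply_mem x), map_zero]
  rw [← sub_eq_zero, ← h0]
  abel

theorem IsOrthogonalCyclicPair.isSpectralMeasure (h : IsOrthogonalCyclicPair U φ η)
    (h₁ : IsCyclicModel U φ μ₁ V₁) (h₂ : IsCyclicModel U η μ₂ V₂) (f : Lp ℂ 2 μ₁)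
    (g : Lp ℂ 2 μ₂) :
    IsSpectralMeasure U (V₁ f + V₂ g) (sqDensity μ₁ f + sqDensity μ₂ g) :=
  (h₁.isSpectralMeasure f).add (h₂.isSpectralMeasure g) fun n => by
    rw [← h₂.map_mulPow]
    exact h.inner_model h₁ h₂ _ _

end Pair

/-- A finite measure is absolutely continuous outside a Lebesgue null set. -/
theorem exists_null_set_restrict_compl_ac (μ : Measure Circle) [IsFiniteMeasure μ] :
    ∃ N, MeasurableSet N ∧ arcLength N = 0 ∧ μ.restrict Nᶜ ≪ arcLength := by
  obtain ⟨s, hs, h1, h2⟩ := Measure.mutuallySingular_singularPart μ arcLength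
  refine ⟨sᶜ, hs.compl, h2, ?_⟩
  rw [compl_compl]
  have h3 : μ.restrict s = (arcLength.withDensity (μ.rnDeriv arcLength)).restrict s := by
    conv_lhs => rw [← Measure.singularPart_add_rnDeriv μ arcLength]
    rw [Measure.restrict_add, Measure.restrict_eq_zero.mpr h1, zero_add]
  rw [h3]
  exact Measure.restrict_le_self.absolutelyContinuous.trans (withDensity_absolutelyContinuous _ _)

theorem sqDensity_indicator (μ : Measure Circle) [IsFiniteMeasure μ] {N : Set Circle}
    (hN : MeasurableSet N) :
    sqDensity μ (indicatorConstLp 2 hN (measure_ne_top μ N) (1 : ℂ)) = μ.restrict N := by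
  rw [sqDensity, ← withDensity_indicator_one hN]
  refine withDensity_congr_ae ?_
  filter_upwards [indicatorConstLp_coeFn (p := 2) (hs := hN) (hμs := measure_ne_top μ N)
    (c := (1 : ℂ))] with z hz
  rw [hz]
  by_cases h : z ∈ N <;> simp [h]

/-- Off N the measure |f|²μ is both absolutely continuous and singular, so it vanishes. -/
theorem ae_eq_zero_of_sqDensity_mutuallySingular {μ : Measure Circle} {N : Set Circle}
    (hN : MeasurableSet N) (hac : μ.restrict Nᶜ ≪ arcLength) {f : Lp ℂ 2 μ}
    (hf : sqDensity μ f ⟂ₘ arcLength) : ∀ᵐ z ∂μ, z ∈ Nᶜ → f z = 0 := by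
  have h1 : (sqDensity μ f).restrict Nᶜ ≪ arcLength :=
    ((sqDensity_absolutelyContinuous f).restrict _).trans hac
  have h2 : (sqDensity μ f).restrict Nᶜ = 0 :=
    Measure.eq_zero_of_absolutelyContinuous_of_mutuallySingular h1
      (hf.mono_ac Measure.restrict_le_self.absolutelyContinuous Measure.AbsolutelyContinuous.rfl)
  rw [sqDensity, restrict_withDensity hN.compl, withDensity_eq_zero_iff
    (measurable_sqDensity f).aemeasurable, Filter.EventuallyEq,
    ae_restrict_iff' hN.compl] at h2
  filter_upwards [h2] with z hz hzN
  simpa using hz hzN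

theorem inner_mulPow_indicator {μ : Measure Circle} [IsFiniteMeasure μ] {N : Set Circle}
    (hN : MeasurableSet N) (f : Lp ℂ 2 μ) (n : ℤ) :
    ⟪f, mulPow μ n (indicatorConstLp 2 hN (measure_ne_top μ N) (1 : ℂ))⟫_ℂ
      = ∫ z in N, (z : ℂ) ^ n * conj (f z) ∂μ := by
  rw [L2.inner_def, ← integral_indicator hN]
  refine integral_congr_ae ?_
  filter_upwards [coeFn_mulPow n (indicatorConstLp 2 hN (measure_ne_top μ N) (1 : ℂ)),
    indicatorConstLp_coeFn (p := 2) (hs := hN) (hμs := measure_ne_top μ N)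
    (c := (1 : ℂ))] with z h1 h2
  rw [h1, h2]
  by_cases h : z ∈ N <;> simp [h]

/-- If two functions on mutually singular measures have opposite moments, both vanish. -/
theorem ae_eq_zero_of_moments {σ₁ σ₂ : Measure Circle} [IsFiniteMeasure σ₁] [IsFiniteMeasure σ₂]
    (hs : σ₁ ⟂ₘ σ₂) {f g : Circle → ℂ} (hfm : Measurable f) (hgm : Measurable g)
    (hf : MemLp f 2 σ₁) (hg : MemLp g 2 σ₂)
    (h : ∀ n : ℤ, ∫ z, (z : ℂ) ^ n * conj (f z) ∂σ₁ + ∫ z, (z : ℂ) ^ n * conj (g z) ∂σ₂ = 0) :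
    f =ᵐ[σ₁] 0 ∧ g =ᵐ[σ₂] 0 := by
  classical
  -- σ₁ lives off A and σ₂ on A, so f and g glue to one function k in L²(σ₁ + σ₂) orthogonal to
  -- every monomial.
  obtain ⟨A, hA, h1, h2⟩ := hs
  let k := A.piecewise g f
  have hkm : Measurable k := hgm.piecewise hA hfm
  have hk1 : k =ᵐ[σ₁] f := by
    filter_upwards [compl_mem_ae_iff.mpr h1] with z hz
    exact Set.piecewise_eq_of_notMem _ _ _ hz
  have hk2 : k =ᵐ[σ₂] g := by
    filter_upwards [mem_ae_iff.mpr h2] with z hz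
    exact Set.piecewise_eq_of_mem _ _ _ hz
  have hk : MemLp k 2 (σ₁ + σ₂) := by
    rw [memLp_two_iff_integrable_sq_norm hkm.aestronglyMeasurable, integrable_add_measure]
    exact ⟨(memLp_two_iff_integrable_sq_norm hkm.aestronglyMeasurable).mp (hf.ae_eq hk1.symm),
      (memLp_two_iff_integrable_sq_norm hkm.aestronglyMeasurable).mp (hg.ae_eq hk2.symm)⟩
  have hint : ∀ n : ℤ, Integrable (fun z : Circle => (z : ℂ) ^ n * conj (k z)) (σ₁ + σ₂) := by
    intro n
    refine (hk.integrable (by norm_num)).norm.mono' ?_ (ae_of_all _ fun z => ?_)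
    · have : Measurable fun z : Circle => (z : ℂ) ^ n := by
        simpa using! (circlePow n).continuous.measurable
      exact (this.mul (continuous_conj.measurable.comp hkm)).aestronglyMeasurable
    · simp [Circle.norm_coe]
  have hz : hk.toLp k = 0 := eq_zero_of_inner_circlePow fun n => by
    rw [L2.inner_def]
    have e : ∫ z, ⟪hk.toLp k z, ContinuousMap.toLp (E := ℂ) 2 (σ₁ + σ₂) ℂ (circlePow n) z⟫_ℂ
        ∂(σ₁ + σ₂) = ∫ z, (z : ℂ) ^ n * conj (k z) ∂(σ₁ + σ₂) := by
      refine integral_congr_ae ?_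
      filter_upwards [hk.coeFn_toLp, ContinuousMap.coeFn_toLp (p := 2) (𝕜 := ℂ) (σ₁ + σ₂)
        (circlePow n)] with z e1 e2
      rw [e1, e2]
      simp
    rw [e, integral_add_measure (hint n).left_of_add_measure (hint n).right_of_add_measure,
      ← h n]
    congr 1
    · exact integral_congr_ae (by filter_upwards [hk1] with z hz; rw [hz])
    · exact integral_congr_ae (by filter_upwards [hk2] with z hz; rw [hz])
  have hk0 : k =ᵐ[σ₁ + σ₂] 0 := (hk.coeFn_toLp).symm.trans (hz ▸ Lp.coeFn_zero _ _ _)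
  rw [Filter.EventuallyEq, ae_add_measure_iff] at hk0
  exact ⟨hk1.symm.trans hk0.1, hk2.symm.trans hk0.2⟩

theorem IsOrthogonalCyclicPair.hasSimpleSingularSpectrum [CompleteSpace H] {U : H ≃ₗᵢ[ℂ] H}
    {φ η : H} (h : IsOrthogonalCyclicPair U φ η) {μ₁ μ₂ : Measure Circle}
    (hμ₁ : IsSpectralMeasure U φ μ₁) (hμ₂ : IsSpectralMeasure U η μ₂)
    (hsing : ∀ N, MeasurableSet N → arcLength N = 0 → μ₁.restrict N ⟂ₘ μ₂.restrict N) :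
    HasSimpleSingularSpectrum U := by
  have := hμ₁.1
  have := hμ₂.1
  obtain ⟨V₁, h₁⟩ := exists_isCyclicModel hμ₁
  obtain ⟨V₂, h₂⟩ := exists_isCyclicModel hμ₂
  obtain ⟨N, hN, hN0, hac⟩ := exists_null_set_restrict_compl_ac (μ₁ + μ₂)
  have hac₁ : μ₁.restrict Nᶜ ≪ arcLength := Measure.AbsolutelyContinuous.trans
    (Measure.restrict_mono_measure (Measure.le_add_right le_rfl) _).absolutelyContinuous hac
  have hac₂ : μ₂.restrict Nᶜ ≪ arcLength := Measure.AbsolutelyContinuous.trans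
    (Measure.restrict_mono_measure (Measure.le_add_left le_rfl) _).absolutelyContinuous hac
  set u₁ := indicatorConstLp 2 hN (measure_ne_top μ₁ N) (1 : ℂ) with hu₁
  set u₂ := indicatorConstLp 2 hN (measure_ne_top μ₂ N) (1 : ℂ) with hu₂
  set w := V₁ u₁ + V₂ u₂ with hw
  have hσ : IsSpectralMeasure U w (μ₁.restrict N + μ₂.restrict N) := by
    rw [← sqDensity_indicator μ₁ hN, ← sqDensity_indicator μ₂ hN]
    exact h.isSpectralMeasure h₁ h₂ u₁ u₂
  have hσs : μ₁.restrict N + μ₂.restrict N ⟂ₘ arcLength := by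
    refine Measure.MutuallySingular.mk (s := Nᶜ) (t := N) ?_ hN0 (by simp)
    simp [Measure.restrict_apply hN.compl]
  refine ⟨w, ⟨_, hσ, hσs⟩, Set.Subset.antisymm ?_ ?_⟩
  -- Spectral measures of vectors in the cyclic subspace of w have the form |f|²σ, with σ the
  -- singular measure of w.
  · intro x hx
    obtain ⟨V, hV⟩ := exists_isCyclicModel hσ
    obtain ⟨f, rfl⟩ := hV.exists_eq hx
    exact ⟨_, hV.isSpectralMeasure f, hσs.mono_ac (sqDensity_absolutelyContinuous f)
      Measure.AbsolutelyContinuous.rfl⟩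
  · rintro x ⟨κ, hκ, hκs⟩
    obtain ⟨f, g, rfl⟩ := h.exists_eq_add h₁ h₂ x
    rw [hκ.unique (h.isSpectralMeasure h₁ h₂ f g), Measure.MutuallySingular.add_left_iff] at hκs
    have hf := ae_eq_zero_of_sqDensity_mutuallySingular hN hac₁ hκs.1
    have hg := ae_eq_zero_of_sqDensity_mutuallySingular hN hac₂ hκs.2
    -- It remains to test x against each y orthogonal to the cyclic subspace of w. The components of
    -- x vanish off N, and those of y will vanish on N.
    rw [SetLike.mem_coe, ← Submodule.orthogonal_orthogonal (cyclicSubspace U w)]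
    intro y hy
    obtain ⟨f', g', rfl⟩ := h.exists_eq_add h₁ h₂ y
    have hmom : ∀ n : ℤ, ∫ z, (z : ℂ) ^ n * conj (f' z) ∂(μ₁.restrict N)
        + ∫ z, (z : ℂ) ^ n * conj (g' z) ∂(μ₂.restrict N) = 0 := by
      intro n
      rw [← inner_mulPow_indicator hN f' n, ← inner_mulPow_indicator hN g' n,
        ← h.inner_add_add h₁ h₂, h₁.map_mulPow, h₂.map_mulPow, ← map_add, ← hw,
        ← inner_conj_symm, mem_cyclicSubspace_orthogonal.mp hy n, map_zero]
    obtain ⟨hf', hg'⟩ := ae_eq_zero_of_moments (hsing N hN hN0)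
      (Lp.stronglyMeasurable f').measurable (Lp.stronglyMeasurable g').measurable
      ((Lp.memLp f').restrict N) ((Lp.memLp g').restrict N) hmom
    rw [Filter.EventuallyEq, ae_restrict_iff' hN] at hf' hg'
    rw [h.inner_add_add h₁ h₂, L2.inner_def, L2.inner_def]
    have e1 : ∫ z, ⟪f' z, f z⟫_ℂ ∂μ₁ = 0 := by
      refine integral_eq_zero_of_ae ?_
      filter_upwards [hf, hf'] with z a b
      by_cases hz : z ∈ N
      · simp [b hz]
      · simp [a hz]
    have e2 : ∫ z, ⟪g' z, g z⟫_ℂ ∂μ₂ = 0 := by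
      refine integral_eq_zero_of_ae ?_
      filter_upwards [hg, hg'] with z a b
      by_cases hz : z ∈ N
      · simp [b hz]
      · simp [a hz]
    rw [e1, e2, add_zero]

/-- The orthogonal complement of the cyclic subspace is U-invariant and the reflection fixes it
pointwise. -/
theorem zpow_mul_reflection_apply {U : H ≃ₗᵢ[ℂ] H} {φ x : H}
    (hx : x ∈ (cyclicSubspace U φ)ᗮ) (n : ℤ) :
    ((U * (Submodule.span ℂ {φ})ᗮ.reflection) ^ n) x = (U ^ n) x := by
  set R := (Submodule.span ℂ {φ})ᗮ.reflection with hR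
  have hfix : ∀ y ∈ (cyclicSubspace U φ)ᗮ, R y = y := fun y hy => by
    rw [hR, reflection_singleton_orthogonal_apply, hy φ (self_mem_cyclicSubspace U φ)]
    simp
  have hpow := zpow_mem_cyclicSubspace_orthogonal hx
  have hstep : ∀ m : ℤ, (U * R) ((U ^ m) x) = (U ^ (m + 1)) x := fun m => by
    rw [isometryEquiv_mul_apply, hfix _ (hpow m), add_comm, zpow_one_add]
    rfl
  induction n using Int.induction_on with
  | zero => simp
  | succ n ih => rw [add_comm, zpow_one_add, isometryEquiv_mul_apply, ih, hstep, add_comm]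
  | pred n ih =>
    apply (U * R).injective
    rw [hstep, ← isometryEquiv_mul_apply, ← zpow_one_add, add_sub_cancel, sub_add_cancel, ih]

/-- A unitary operator has simple singular spectrum if a reflection of one vector turns it into
a unitary operator with two orthogonal cyclic subspaces, each generated by a component of that
vector. -/
theorem hasSimpleSingularSpectrum_of_reflection [CompleteSpace H] {U : H ≃ₗᵢ[ℂ] H} {φ₁ φ₂ : H}
    (hφ : φ₁ + φ₂ ≠ 0)
    (h : IsOrthogonalCyclicPair (U * (Submodule.span ℂ {φ₁ + φ₂})ᗮ.reflection) φ₁ φ₂) :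
    HasSimpleSingularSpectrum U := by
  set φ := φ₁ + φ₂ with hφdef
  set U' := U * (Submodule.span ℂ {φ})ᗮ.reflection with hU'
  set C := cyclicSubspace U φ with hC
  set η := φ₁ - C.starProjection φ₁ with hη
  have hηC : η ∈ Cᗮ := C.sub_starProjection_mem_orthogonal φ₁
  obtain ⟨μ, hμ⟩ := exists_isSpectralMeasure U φ
  obtain ⟨μη, hμη⟩ := exists_isSpectralMeasure U η
  obtain ⟨ν₁, hν₁⟩ := exists_isSpectralMeasure U' φ₁
  obtain ⟨ν₂, hν₂⟩ := exists_isSpectralMeasure U' φ₂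
  have := hν₁.1
  have := hν₂.1
  have hν : IsSpectralMeasure U' φ (ν₁ + ν₂) := hν₁.add hν₂ h.inner_eq_zero
  -- η has the same moments under U and U', so its measure can be computed in the U'-model, where it
  -- is |f|²ν₁ + |g|²ν₂.
  have hac : μη ≪ ν₁ + ν₂ := by
    obtain ⟨V₁, h₁⟩ := exists_isCyclicModel hν₁
    obtain ⟨V₂, h₂⟩ := exists_isCyclicModel hν₂
    obtain ⟨f, g, hfg⟩ := h.exists_eq_add h₁ h₂ η
    have hμη' : IsSpectralMeasure U' η μη :=
      ⟨hμη.1, fun n => by rw [hU', zpow_mul_reflection_apply hηC, hμη.2]⟩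
    rw [hfg] at hμη'
    rw [hμη'.unique (h.isSpectralMeasure h₁ h₂ f g)]
    exact (sqDensity_absolutelyContinuous f).add (sqDensity_absolutelyContinuous g)
  have hpair : IsOrthogonalCyclicPair U φ η := by
    refine ⟨fun n => ?_, fun x hx hxη => ?_⟩
    · exact zpow_mem_cyclicSubspace_orthogonal hηC n φ (self_mem_cyclicSubspace U φ)
    -- Orthogonality to the U-orbits of φ and η gives it for φ₁ and φ₂. It passes to the U'-orbits
    -- because U and U' have the same powers at x.
    · have hx₁ : ∀ n : ℤ, ⟪(U ^ n) φ₁, x⟫_ℂ = 0 := fun n => by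
        have e : φ₁ = η + C.starProjection φ₁ := by rw [hη, sub_add_cancel]
        rw [e, map_add, inner_add_left, mem_cyclicSubspace_orthogonal.mp hxη n,
          hx _ (zpow_mem_cyclicSubspace (C.starProjection_apply_mem φ₁) n), add_zero]
      have hx₂ : ∀ n : ℤ, ⟪(U ^ n) φ₂, x⟫_ℂ = 0 := fun n => by
        have e : φ₂ = φ - φ₁ := by rw [hφdef, add_sub_cancel_left]
        rw [e, map_sub, inner_sub_left, hx₁, mem_cyclicSubspace_orthogonal.mp hx n, sub_zero]
      have hU'x : ∀ (n : ℤ) (y : H), ⟪(U' ^ n) y, x⟫_ℂ = ⟪(U ^ n) y, x⟫_ℂ := fun n y => by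
        rw [inner_zpow_left, hU', zpow_mul_reflection_apply hx, ← inner_zpow_left]
      exact h.eq_zero x (mem_cyclicSubspace_orthogonal.mpr fun n => (hU'x n _).trans (hx₁ n))
        (mem_cyclicSubspace_orthogonal.mpr fun n => (hU'x n _).trans (hx₂ n))
  refine hpair.hasSimpleSingularSpectrum hμ hμη fun N hNm hN => ?_
  have hs : ∀ κ : Measure Circle, κ.restrict N ⟂ₘ arcLength := fun κ => by
    refine (Measure.MutuallySingular.mk (s := N) (t := Nᶜ) hN ?_ (by simp)).symm
    simp [Measure.restrict_apply hNm.compl]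
  exact (mutuallySingular_of_reflection hφ hμ hν Measure.restrict_le_self
    Measure.restrict_le_self (hs μ) (hs (ν₁ + ν₂))).mono_ac
    Measure.AbsolutelyContinuous.rfl (hac.restrict N)

end Abstract

/-! ### The extended CMV matrix -/

theorem rho_pos (a : UnitDisc) : 0 < rho a :=
  Real.sqrt_pos.mpr (by linarith [a.sq_norm_lt_one])

theorem coe_rho_ne_zero (a : UnitDisc) : (rho a : ℂ) ≠ 0 := by
  exact_mod_cast (rho_pos a).ne'

theorem blockFun_of_even {s j : ℤ} (h : Even (j - s)) (α : ℤ → UnitDisc) (u : ℤ → ℂ) :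
    blockFun s α u j = conj (α j : ℂ) * u j + rho (α j) * u (j + 1) := by
  simp [blockFun, h, Theta]

theorem blockFun_succ_of_even {s j : ℤ} (h : Even (j - s)) (α : ℤ → UnitDisc) (u : ℤ → ℂ) :
    blockFun s α u (j + 1) = rho (α j) * u j - α j * u (j + 1) := by
  simp [blockFun, not_even_add_one_sub h, Theta]
  ring

/-- Since ρ ≠ 0, the input and output of a 2 × 2 block at one index determine those at the other:
this is the transfer-matrix recursion. -/
theorem blockFun_zero_succ {s j : ℤ} (h : Even (j - s)) (α : ℤ → UnitDisc) {u : ℤ → ℂ}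
    (h1 : u j = 0) (h2 : blockFun s α u j = 0) : u (j + 1) = 0 ∧ blockFun s α u (j + 1) = 0 := by
  rw [blockFun_of_even h, h1, mul_zero, zero_add] at h2
  have h3 := (mul_eq_zero.mp h2).resolve_left (coe_rho_ne_zero _)
  rw [blockFun_succ_of_even h, h1, h3]
  simp

theorem blockFun_zero_of_succ {s j : ℤ} (h : Even (j - s)) (α : ℤ → UnitDisc) {u : ℤ → ℂ}
    (h1 : u (j + 1) = 0) (h2 : blockFun s α u (j + 1) = 0) : u j = 0 ∧ blockFun s α u j = 0 := by
  rw [blockFun_succ_of_even h, h1, mul_zero, sub_zero] at h2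
  have h3 := (mul_eq_zero.mp h2).resolve_left (coe_rho_ne_zero _)
  rw [blockFun_of_even h, h1, h3]
  simp

/-- A set of sequences that is invariant under the extended CMV matrix and its inverse, and whose
members vanish at `0` and `1`, contains only the zero sequence. -/
theorem eq_zero_of_invariant {α : ℤ → UnitDisc} {W : Set L2Z}
    (hE : ∀ y ∈ W, extendedCMV α y ∈ W) (hE' : ∀ y ∈ W, (extendedCMV α).symm y ∈ W)
    (h0 : ∀ y ∈ W, y 0 = 0) (h1 : ∀ y ∈ W, y 1 = 0) : ∀ y ∈ W, y = 0 := by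
  have hLM : ∀ (y : L2Z) (k : ℤ), blockFun 1 α (opM α y) k = extendedCMV α y k := fun y k => rfl
  have hM : ∀ (y : L2Z) (k : ℤ), opM α y k = blockFun 0 α y k := fun y k => rfl
  -- Even k crosses a block of M. Odd k crosses a block of L, whose output is E y; the induction
  -- covers all of W so that it applies to E y too. The conclusion for E y, read at E⁻¹y, then
  -- returns y.
  have key : ∀ k : ℤ, ∀ y ∈ W, y k = 0 ∧ opM α y k = 0 := by
    have up : ∀ k : ℤ, (∀ y ∈ W, y k = 0 ∧ opM α y k = 0) →
        ∀ y ∈ W, y (k + 1) = 0 ∧ opM α y (k + 1) = 0 := by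
      intro k ih y hy
      rcases Int.even_or_odd k with hk | hk
      · exact blockFun_zero_succ (s := 0) (by simpa using hk) α (ih y hy).1 (ih y hy).2
      · have hk' : Even (k - 1) := hk.sub_odd odd_one
        have hL : ∀ y ∈ W, opM α y (k + 1) = 0 ∧ extendedCMV α y (k + 1) = 0 := fun y hy =>
          blockFun_zero_succ (s := 1) hk' α (ih y hy).2 (ih _ (hE y hy)).1
        refine ⟨?_, (hL y hy).1⟩
        have := (hL _ (hE' y hy)).2
        rwa [LinearIsometryEquiv.apply_symm_apply] at this
    have down : ∀ k : ℤ, (∀ y ∈ W, y (k + 1) = 0 ∧ opM α y (k + 1) = 0) →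
        ∀ y ∈ W, y k = 0 ∧ opM α y k = 0 := by
      intro k ih y hy
      rcases Int.even_or_odd k with hk | hk
      · exact blockFun_zero_of_succ (s := 0) (by simpa using hk) α (ih y hy).1 (ih y hy).2
      · have hk' : Even (k - 1) := hk.sub_odd odd_one
        have hL : ∀ y ∈ W, opM α y k = 0 ∧ extendedCMV α y k = 0 := fun y hy =>
          blockFun_zero_of_succ (s := 1) hk' α (ih y hy).2 (ih _ (hE y hy)).1
        refine ⟨?_, (hL y hy).1⟩
        have := (hL _ (hE' y hy)).2
        rwa [LinearIsometryEquiv.apply_symm_apply] at this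
    intro k
    induction k using Int.induction_on with
    | zero =>
      intro y hy
      refine ⟨h0 y hy, ?_⟩
      rw [hM, blockFun_of_even (by simp), h0 y hy, zero_add, h1 y hy]
      simp
    | succ k ih => exact up _ ih
    | pred k ih => exact down _ (by rwa [sub_add_cancel])
  intro y hy
  ext k
  exact (key k y hy).1

/-- The standard basis vector `δ_j`. -/
def delta (j : ℤ) : L2Z := lp.single 2 j (1 : ℂ)

theorem inner_delta (j : ℤ) (u : L2Z) : ⟪delta j, u⟫_ℂ = u j := by
  simp [delta, lp.inner_single_left]

theorem delta_self (j : ℤ) : delta j j = 1 := by simp [delta]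

theorem delta_of_ne {j k : ℤ} (h : k ≠ j) : delta j k = 0 := by simp [delta, h]

/-! ### Splitting the matrix between the sites 0 and 1. -/

section Decoupling

variable (α : ℤ → UnitDisc) (p : ℂ)

/-- The component at `0` of the vector whose reflection decouples the matrix at `0`. -/
def leftVec : L2Z := (((‖(α 0 : ℂ)‖ : ℂ) - 1) * p) • delta 0

/-- The component at `1` of the vector whose reflection decouples the matrix at `0`. -/
def rightVec : L2Z := (rho (α 0) : ℂ) • delta 1

theorem inner_leftVec (u : L2Z) :
    ⟪leftVec α p, u⟫_ℂ = ((‖(α 0 : ℂ)‖ : ℂ) - 1) * conj p * u 0 := by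
  rw [leftVec, inner_smul_left, inner_delta]
  simp

theorem inner_rightVec (u : L2Z) : ⟪rightVec α, u⟫_ℂ = rho (α 0) * u 1 := by
  rw [rightVec, inner_smul_left, inner_delta, conj_ofReal]

theorem leftVec_apply (j : ℤ) :
    leftVec α p j = if j = 0 then ((‖(α 0 : ℂ)‖ : ℂ) - 1) * p else 0 := by
  rw [leftVec, lp.coeFn_smul, Pi.smul_apply, smul_eq_mul]
  split_ifs with h
  · rw [h, delta_self, mul_one]
  · rw [delta_of_ne h, mul_zero]

theorem rightVec_apply (j : ℤ) : rightVec α j = if j = 1 then (rho (α 0) : ℂ) else 0 := by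
  rw [rightVec, lp.coeFn_smul, Pi.smul_apply, smul_eq_mul]
  split_ifs with h
  · rw [h, delta_self, mul_one]
  · rw [delta_of_ne h, mul_zero]

theorem add_vec_ne_zero : leftVec α p + rightVec α ≠ 0 := by
  intro h
  have := congrArg (fun u : L2Z => u 1) h
  simp [leftVec_apply, rightVec_apply] at this
  exact (rho_pos _).ne' this

/-- The unitary operator that splits at `0`. -/
def decoupledCMV : L2Z ≃ₗᵢ[ℂ] L2Z :=
  extendedCMV α * (Submodule.span ℂ {leftVec α p + rightVec α})ᗮ.reflection

variable {p}

theorem norm_sq_add_vec (hp : ‖p‖ = 1) :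
    ((‖leftVec α p + rightVec α‖ ^ 2 : ℝ) : ℂ) = 2 * (1 - (‖(α 0 : ℂ)‖ : ℂ)) := by
  have h1 : conj p * p = 1 := by rw [mul_comm, mul_conj, normSq_eq_norm_sq, hp]; simp
  have h2 : (rho (α 0) : ℂ) * rho (α 0) = 1 - (‖(α 0 : ℂ)‖ : ℂ) ^ 2 := by
    rw [rho_sq, mul_conj, normSq_eq_norm_sq]; push_cast; rfl
  have h3 : ((‖leftVec α p + rightVec α‖ ^ 2 : ℝ) : ℂ)
      = ⟪leftVec α p + rightVec α, leftVec α p + rightVec α⟫_ℂ := by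
    rw [inner_self_eq_norm_sq_to_K]; push_cast; rfl
  rw [h3, inner_add_left, inner_leftVec, inner_rightVec]
  simp only [lp.coeFn_add, Pi.add_apply, leftVec_apply, rightVec_apply]
  norm_num
  linear_combination ((‖(α 0 : ℂ)‖ : ℂ) - 1) ^ 2 * h1 + h2

/-- With s = |α_0|, the vector was chosen as the -1 eigenvector of Θ(α_0)⁻¹ diag(p̄, p), the
self-adjoint unitary with rows (s, ρp) and (ρp̄, -s). Hence R equals this matrix on the span of δ_0,
δ_1, and Θ(α_0)R is diagonal. -/
theorem opM_reflection_apply (hp : ‖p‖ = 1) (hα : (α 0 : ℂ) = ‖(α 0 : ℂ)‖ * p) (u : L2Z)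
    (j : ℤ) :
    opM α ((Submodule.span ℂ {leftVec α p + rightVec α})ᗮ.reflection u) j
      = if j = 0 then conj p * u 0 else if j = 1 then p * u 1 else blockFun 0 α u j := by
  set R := (Submodule.span ℂ {leftVec α p + rightVec α})ᗮ.reflection with hR
  set s : ℂ := (‖(α 0 : ℂ)‖ : ℂ) with hs
  have h1 : conj p * p = 1 := by rw [mul_comm, mul_conj, normSq_eq_norm_sq, hp]; simp
  have h2 : (rho (α 0) : ℂ) * rho (α 0) = 1 - s ^ 2 := by
    rw [rho_sq, mul_conj, normSq_eq_norm_sq, hs]; push_cast; rfl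
  have hs1 : 1 - s ≠ 0 := by
    rw [hs, ← ofReal_one, ← ofReal_sub, Ne, ofReal_eq_zero]
    linarith [(α 0).norm_lt_one]
  have hconj : conj (α 0 : ℂ) = s * conj p := by
    rw [hα, map_mul]
    simp [hs]
  set c : ℂ := ((s - 1) * conj p * u 0 + rho (α 0) * u 1) / (1 - s) with hc
  have hcs : c * (1 - s) = (s - 1) * conj p * u 0 + rho (α 0) * u 1 := div_mul_cancel₀ _ hs1
  have hRu : ∀ k, R u k = u k - c * ((if k = 0 then (s - 1) * p else 0)
      + if k = 1 then (rho (α 0) : ℂ) else 0) := by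
    intro k
    have e : 2 * (⟪leftVec α p + rightVec α, u⟫_ℂ
        / ((‖leftVec α p + rightVec α‖ ^ 2 : ℝ) : ℂ)) = c := by
      rw [norm_sq_add_vec α hp, inner_add_left, inner_leftVec, inner_rightVec, hc,
        ← hs]
      field_simp
    rw [hR, reflection_singleton_orthogonal_apply, e, lp.coeFn_sub, Pi.sub_apply, lp.coeFn_smul,
      Pi.smul_apply, smul_eq_mul, lp.coeFn_add, Pi.add_apply, leftVec_apply, rightVec_apply]
  have hR0 : R u 0 = s * u 0 + rho (α 0) * p * u 1 := by
    rw [hRu]; norm_num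
    linear_combination p * hcs - (1 - s) * u 0 * h1
  have hR1 : R u 1 = rho (α 0) * conj p * u 0 - s * u 1 := by
    have : (1 - s) * R u 1 = (1 - s) * (rho (α 0) * conj p * u 0 - s * u 1) := by
      rw [hRu, if_neg one_ne_zero, if_pos rfl]
      linear_combination -(rho (α 0) : ℂ) * hcs - u 1 * h2
    exact mul_left_cancel₀ hs1 this
  change blockFun 0 α (R u) j = _
  split_ifs with hj0 hj1
  · rw [hj0, blockFun_of_even (by simp), zero_add, hR0, hR1, hconj]
    linear_combination conj p * u 0 * h2 + s * rho (α 0) * u 1 * h1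
  · rw [hj1, ← zero_add (1 : ℤ), blockFun_succ_of_even (by simp), zero_add, hR0, hR1, hα]
    linear_combination p * u 1 * h2 - s * rho (α 0) * u 0 * h1
  · have hR' : ∀ k, k ≠ 0 → k ≠ 1 → R u k = u k := fun k a b => by simp [hRu, a, b]
    unfold blockFun
    split_ifs with he
    · rw [hR' j hj0 hj1, hR' (j + 1) (by grind) (by grind)]
    · rw [hR' j hj0 hj1, hR' (j - 1) (by grind) (by grind)]

theorem decoupledCMV_right (hp : ‖p‖ = 1) (hα : (α 0 : ℂ) = ‖(α 0 : ℂ)‖ * p) {u : L2Z}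
    (hu : ∀ j ≤ 0, u j = 0) : ∀ j ≤ 0, decoupledCMV α p u j = 0 := by
  have hM : ∀ j ≤ 0, opM α ((Submodule.span ℂ {leftVec α p + rightVec α})ᗮ.reflection u) j
      = 0 := by
    intro j hj
    rw [opM_reflection_apply α hp hα]
    split_ifs with h0 h1
    · rw [hu 0 le_rfl, mul_zero]
    · omega
    · unfold blockFun
      split_ifs with he
      · rw [hu j hj, hu (j + 1) (by omega)]; simp
      · rw [hu j hj, hu (j - 1) (by omega)]; simp
  intro j hj
  change blockFun 1 α (opM α
    ((Submodule.span ℂ {leftVec α p + rightVec α})ᗮ.reflection u)) j = 0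
  unfold blockFun
  split_ifs with he
  -- Here j is odd, so j ≤ 0 forces j + 1 ≤ 0: no block of L joins 0 to 1.
  · rw [hM j hj, hM (j + 1) (by grind)]; simp
  · rw [hM j hj, hM (j - 1) (by omega)]; simp

theorem decoupledCMV_left (hp : ‖p‖ = 1) (hα : (α 0 : ℂ) = ‖(α 0 : ℂ)‖ * p) {u : L2Z}
    (hu : ∀ j, 1 ≤ j → u j = 0) : ∀ j, 1 ≤ j → decoupledCMV α p u j = 0 := by
  have hM : ∀ j, 1 ≤ j → opM α
      ((Submodule.span ℂ {leftVec α p + rightVec α})ᗮ.reflection u) j = 0 := by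
    intro j hj
    rw [opM_reflection_apply α hp hα]
    split_ifs with h0 h1
    · omega
    · rw [hu 1 le_rfl, mul_zero]
    · unfold blockFun
      split_ifs with he
      · rw [hu j hj, hu (j + 1) (by omega)]; simp
      · rw [hu j hj, hu (j - 1) (by omega)]; simp
  intro j hj
  change blockFun 1 α (opM α
    ((Submodule.span ℂ {leftVec α p + rightVec α})ᗮ.reflection u)) j = 0
  unfold blockFun
  split_ifs with he
  · rw [hM j hj, hM (j + 1) (by omega)]; simp
  · rw [hM j hj, hM (j - 1) (by grind)]; simp

theorem isOrthogonalCyclicPair_decoupledCMV (hp : ‖p‖ = 1)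
    (hα : (α 0 : ℂ) = ‖(α 0 : ℂ)‖ * p) :
    IsOrthogonalCyclicPair (decoupledCMV α p) (leftVec α p) (rightVec α) := by
  set U := decoupledCMV α p with hU
  refine ⟨fun n => ?_, ?_⟩
  · obtain ⟨m, rfl | rfl⟩ := n.eq_nat_or_neg
    · have h : ∀ m : ℕ, ∀ j ≤ 0, (U ^ (m : ℤ)) (rightVec α) j = 0 := by
        intro m
        induction m with
        | zero => intro j hj; simp [rightVec_apply]; omega
        | succ m ih =>
          rw [Nat.cast_succ, add_comm, zpow_one_add, isometryEquiv_mul_apply]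
          exact decoupledCMV_right α hp hα ih
      rw [inner_leftVec, h m 0 le_rfl, mul_zero]
    -- Negative powers move to the other side of the inner product, so forward invariance of the two
    -- half-lines suffices.
    · have h : ∀ m : ℕ, ∀ j, 1 ≤ j → (U ^ (m : ℤ)) (leftVec α p) j = 0 := by
        intro m
        induction m with
        | zero => intro j hj; simp [leftVec_apply]; omega
        | succ m ih =>
          rw [Nat.cast_succ, add_comm, zpow_one_add, isometryEquiv_mul_apply]
          exact decoupledCMV_left α hp hα ih
      rw [← inner_zpow_left, ← inner_conj_symm, inner_rightVec, h m 1 le_rfl, mul_zero, map_zero]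
  · intro x hx hx'
    have hp0 : p ≠ 0 := by
      rintro rfl
      simp at hp
    have hs1 : (‖(α 0 : ℂ)‖ : ℂ) - 1 ≠ 0 := by
      rw [← ofReal_one, ← ofReal_sub, Ne, ofReal_eq_zero]
      linarith [(α 0).norm_lt_one]
    -- Vectors of W are orthogonal to φ₁ and φ₂. They therefore vanish at 0 and 1 and are fixed by
    -- the reflection, so W is invariant under E and its inverse.
    let W : Set L2Z := {y | y ∈ (cyclicSubspace U (leftVec α p))ᗮ ∧
      y ∈ (cyclicSubspace U (rightVec α))ᗮ}
    have hpow : ∀ n : ℤ, ∀ y ∈ W, (U ^ n) y ∈ W := fun n y hy =>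
      ⟨zpow_mem_cyclicSubspace_orthogonal hy.1 n, zpow_mem_cyclicSubspace_orthogonal hy.2 n⟩
    have hl : ∀ y ∈ W, ⟪leftVec α p, y⟫_ℂ = 0 := fun y hy => hy.1 _ (self_mem_cyclicSubspace _ _)
    have hr : ∀ y ∈ W, ⟪rightVec α, y⟫_ℂ = 0 := fun y hy => hy.2 _ (self_mem_cyclicSubspace _ _)
    have hUE : ∀ y ∈ W, U y = extendedCMV α y := fun y hy => by
      rw [hU, decoupledCMV, isometryEquiv_mul_apply, reflection_singleton_orthogonal_apply,
        inner_add_left, hl y hy, hr y hy]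
      simp
    refine eq_zero_of_invariant (α := α) (W := W) (fun y hy => ?_) (fun y hy => ?_)
      (fun y hy => ?_) (fun y hy => ?_) x ⟨hx, hx'⟩
    · rw [← hUE y hy]
      simpa using hpow 1 y hy
    · have hz : U.symm y ∈ W := by
        have := hpow (-1) y hy
        rwa [zpow_neg_one] at this
      have h2 := hUE _ hz
      rw [LinearIsometryEquiv.apply_symm_apply] at h2
      rwa [h2, LinearIsometryEquiv.symm_apply_apply]
    · have := hl y hy
      rw [inner_leftVec] at this
      simpa [hs1, hp0] using this
    · have := hr y hy
      rw [inner_rightVec] at this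
      simpa [coe_rho_ne_zero, (rho_pos (α 0)).ne'] using this

end Decoupling

end ExtCMV

end

theorem theorem5p1 (α : ℤ → Complex.UnitDisc) :
    ExtCMV.HasSimpleSingularSpectrum (ExtCMV.extendedCMV α) := by
  -- The phase p of α_0; if α_0 = 0 the convention arg 0 = 0 gives p = 1, and any unimodular p would
  -- serve.
  have hp : ‖Complex.exp (Complex.arg (α 0 : ℂ) * Complex.I)‖ = 1 :=
    Complex.norm_exp_ofReal_mul_I _
  exact ExtCMV.hasSimpleSingularSpectrum_of_reflection (ExtCMV.add_vec_ne_zero α _)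
    (ExtCMV.isOrthogonalCyclicPair_decoupledCMV α hp (Complex.norm_mul_exp_arg_mul_I _).symm)
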